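/- **Model.** $n\ge 1$ processes communicate through atomic read/write registers. Each process alternates between coin flip steps and shared memory steps (reads or writes), starting with a coin flip. Coin flips are private, independent, and take values in a countable space $\Omega$ with a fixed distribution $\mathcal D$. A process that has finished makes a no-op when scheduled. An execution is the sequence of the steps taken (process, type of step, register, value). An adversary maps each finite execution of an algorithm to the process that takes the next step; an algorithm $M$ and an adversary $A$ thus yield a random execution $\mathcal E_{M,A}$. The adversary $A$ is *r/w-oblivious* for $M$ if its choice after a finite execution $\mathcal E$ of $M$ depends only on (i) the schedule of $\mathcal E$, (ii) for each process $p$, the results of the coin flips of $p$ that precede $p$'s latest shared memory step in $\mathcal E$, and (iii) for each process whose next step is a shared memory step, the register it will access. **The algorithm.** Let $b=3/2$, $q_i=2^{-b^{\,i-1}}$ for $i\ge1$, and $\ell=\lceil\log_b\log_2 n\rceil$ (put $\ell=1$ if $n\le 2$). The shared registers $Up[1..\ell]$ and $Down[1..\ell-1]$ are initially $0$. The method $\mathrm{elect}()$ is as follows. * Backward phase: for $i=1,2,\dots$, choose heads with probability $q_i$ and tails otherwise. On heads, write $1$ to $Up[i]$, and then continue with $i+1$ if $i<\ell$, or end the phase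 if $i=\ell$. On tails, read $Up[i]$; if the value is $1$, return *lose*, otherwise end the phase. * Forward phase: let $j$ be the index at which the backward phase ended. For $i=j-1,j-2,\dots,1$, choose heads with probability $q_i$ and tails otherwise. On heads, write $1$ to $Down[i]$. On tails, read $Down[i]$; if the value is $1$, return *lose*. * Return *win*. **Measures.** Let $M$ be any $n$-process algorithm, possibly using other registers, in which each process calls $\mathrm{elect}()$ of one such object at most once in every execution. For $1\le k\le n$ let $\mathrm{Exec}_{M,A}(k)$ be the set of finite executions $\mathcal E'$ that can result for $A$, that end when the first process becomes poised to invoke $\mathrm{elect}()$, and such that in every execution of $M$ extending $\mathcal E'$ at most $k$ processes invoke $\mathrm{elect}()$. The effectiveness in $M$ against $A$ is $$\varphi(k)=\sup_{\mathcal E'\in \mathrm{Exec}_{M,A}(k)}\mathbb E\bigl[\#\{p:\ p\text{'s call returns } win\}\ \big|\ \mathcal E_{M,A}\text{ extends }\mathcal E'\bigr],$$ and the (adaptive) expected max-step complexity is $$\tau(k)=\sup_{\mathcal E'\in \mathrm{Exec}_{M,A}(k)}\mathbb E\bigl[\max_p T_p\ \big|\ \mathcal E_{M,A}\text{ extends }\mathcal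 E'\bigr],$$ where $T_p$ is the number of shared memory steps that $p$ makes during its call of $\mathrm{elect}()$. **Lemma.** The algorithm implements group election: in every execution of every such $M$ in which at least one process calls $\mathrm{elect}()$ and all calls of $\mathrm{elect}()$ return, at least one call returns *win*. Moreover, for every such $M$, every r/w-oblivious adversary $A$ for $M$, and every $1\le k\le n$: 1. $\varphi(k)\le 16$; 2. $\tau(k)\le 2\lceil\log_{3/2}\log_2\max\{k,2\}\rceil+7$; 3. $\tau(k)\le C\log_2\log_2 k$ if $k\ge3$, where $C$ is an absolute constant; that is, the expected max-step complexity is $O(\log\log k)$. -/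

import Mathlib

namespace GroupElect

open MeasureTheory ProbabilityTheory
open scoped ENNReal

/-- The two possible return values of `elect()`. -/
inductive Outcome
  | win
  | lose

/-- A shared memory step on registers `X` storing values in `Y`, followed by local computation
that leads to a result in `T`. -/
inductive Op (X Y T : Type*)
  | read (x : X) (cont : Y → T)
  | write (x : X) (v : Y) (next : T)

/-- The register accessed by a shared memory step. -/
def Op.reg {X Y T : Type*} : Op X Y T → X
  | .read x _ => x
  | .write x _ _ => x

/-- An implementation of the one-time method `elect()` from registers `R` storing values in `W`.
In local state `q : Q` the process makes a coin flip `w` and then the shared memory step `act q w`,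
after which it is either in a new local state or `elect()` returns. -/
structure Impl (Ω Q R W : Type*) where
  start : Q
  init : R → W
  act : Q → Ω → Op R W (Q ⊕ Outcome)

/-- What a process does next in its own code: it has finished, or it makes a coin flip followed by
a shared memory step on the registers `L` of the algorithm, or it calls `elect()` and continues
according to the outcome. -/
inductive Action (Ω L V S : Type*)
  | halt
  | flip (op : Ω → Op L V S)
  | call (cont : Outcome → S)

/-- An `n`-process algorithm that uses one group election object. `S` is the type of local states,
`L` the type of the algorithm's other registers, which store values in `V`. -/
structure Algo (n : ℕ) (Ω L V S : Type*) where
  start : Fin n → S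
  init : L → V
  next : Fin n → S → Action Ω L V S

/-- Control state of a process: in its own code (`code`), in its own code between a coin flip and
the subsequent shared memory step (`codeOp`), inside its `elect()` call before a coin flip (`meth`),
inside its `elect()` call between a coin flip and the subsequent shared memory step (`methOp`). -/
inductive Ctl (L V S Q R W : Type*)
  | code (s : S)
  | codeOp (op : Op L V S)
  | meth (q : Q) (cont : Outcome → S)
  | methOp (op : Op R W (Q ⊕ Outcome)) (cont : Outcome → S)

/-- What happens in a step. A process that has finished makes a no-op when it is scheduled. -/
inductive Event (Ω L V R W : Type*)
  | flip (w : Ω)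
  | read (x : L ⊕ R) (v : V ⊕ W)
  | write (x : L ⊕ R) (v : V ⊕ W)
  | noop

/-- Whether the step is a shared memory step. -/
def Event.isMem {Ω L V R W : Type*} : Event Ω L V R W → Bool
  | .read _ _ => true
  | .write _ _ => true
  | _ => false

/-- The value returned by a coin flip step. -/
def Event.coin {Ω L V R W : Type*} : Event Ω L V R W → Option Ω
  | .flip w => some w
  | _ => none

/-- One entry of an execution. -/
structure Record (n : ℕ) (Ω L V R W : Type*) where
  pid : Fin n
  ev : Event Ω L V R W

/-- The situation after a finite execution `hist` (in chronological order). The last three fields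
record, per process, the number of invocations of `elect()`, the number of shared memory steps made
during `elect()`, and the value returned by `elect()` (if it has returned). -/
structure Config (n : ℕ) (Ω L V S Q R W : Type*) where
  mem : L → V
  gmem : R → W
  ctl : Fin n → Ctl L V S Q R W
  hist : List (Record n Ω L V R W)
  calls : Fin n → ℕ
  steps : Fin n → ℕ
  result : Fin n → Option Outcome

section Model

variable {n : ℕ} {Ω L V S Q R W : Type*}

/-- Append a step of `p` to the execution. -/
def Config.log (c : Config n Ω L V S Q R W) (p : Fin n) (e : Event Ω L V R W) :
    Config n Ω L V S Q R W :=
  { c with hist := c.hist ++ [⟨p, e⟩] }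

/-- Set the control state of `p`. -/
def Config.goto (c : Config n Ω L V S Q R W) (p : Fin n) (x : Ctl L V S Q R W) :
    Config n Ω L V S Q R W :=
  { c with ctl := Function.update c.ctl p x }

/-- Count a shared memory step of `p` inside `elect()`, and then continue `elect()` or return. -/
def Config.resume (c : Config n Ω L V S Q R W) (p : Fin n) (cont : Outcome → S) :
    Q ⊕ Outcome → Config n Ω L V S Q R W
  | .inl q =>
    { c.goto p (.meth q cont) with steps := Function.update c.steps p (c.steps p + 1) }
  | .inr o =>
    { c.goto p (.code (cont o)) with
      steps := Function.update c.steps p (c.steps p + 1)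
      result := Function.update c.result p (some o) }

open Classical in
/-- The next step of process `p`; `w` is the value returned if this step is a coin flip. The call
of `elect()` is invoked with its first coin flip. -/
noncomputable def Config.step (I : Impl Ω Q R W) (M : Algo n Ω L V S)
    (c : Config n Ω L V S Q R W) (p : Fin n) (w : Ω) : Config n Ω L V S Q R W :=
  match c.ctl p with
  | .code s =>
    match M.next p s with
    | .halt => c.log p .noop
    | .flip op => (c.goto p (.codeOp (op w))).log p (.flip w)
    | .call cont =>
      { (c.goto p (.methOp (I.act I.start w) cont)).log p (.flip w) with
        calls := Function.update c.calls p (c.calls p + 1) }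
  | .codeOp (.read x cont) =>
    (c.goto p (.code (cont (c.mem x)))).log p (.read (.inl x) (.inl (c.mem x)))
  | .codeOp (.write x v s) =>
    { (c.goto p (.code s)).log p (.write (.inl x) (.inl v)) with
      mem := Function.update c.mem x v }
  | .meth q cont => (c.goto p (.methOp (I.act q w) cont)).log p (.flip w)
  | .methOp (.read x g) cont =>
    (c.resume p cont (g (c.gmem x))).log p (.read (.inr x) (.inr (c.gmem x)))
  | .methOp (.write x v r) cont =>
    { (c.resume p cont r).log p (.write (.inr x) (.inr v)) with
      gmem := Function.update c.gmem x v }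

/-- The number of coin flips made so far, by all processes together. -/
def Config.flips (c : Config n Ω L V S Q R W) : ℕ :=
  (c.hist.filterMap fun r => r.ev.coin).length

/-- The initial configuration (empty execution). -/
def Config.initial (I : Impl Ω Q R W) (M : Algo n Ω L V S) : Config n Ω L V S Q R W where
  mem := M.init
  gmem := I.init
  ctl p := .code (M.start p)
  hist := []
  calls _ := 0
  steps _ := 0
  result _ := none

/-- The finite execution determined by a finite schedule `σ` and a coin flip vector `ω`: the `i`-th
coin flip among all processes returns `ω i`. -/
noncomputable def run (I : Impl Ω Q R W) (M : Algo n Ω L V S) (σ : List (Fin n)) (ω : ℕ → Ω) :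
    Config n Ω L V S Q R W :=
  σ.foldl (fun c p => c.step I M p (ω c.flips)) (Config.initial I M)

/-- An adversary maps finite executions to the process that takes the next step. -/
abbrev Adversary (n : ℕ) (Ω L V R W : Type*) := List (Record n Ω L V R W) → Fin n

/-- The first `t` steps of the execution scheduled by the adversary `A` with coin flip vector
`ω`. -/
noncomputable def advRun (I : Impl Ω Q R W) (M : Algo n Ω L V S) (A : Adversary n Ω L V R W)
    (ω : ℕ → Ω) : ℕ → Config n Ω L V S Q R W
  | 0 => Config.initial I M
  | t + 1 =>
    (advRun I M A ω t).step I M (A (advRun I M A ω t).hist) (ω (advRun I M A ω t).flips)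

/-- Every process calls `elect()` at most once in every execution. -/
def OneTime (I : Impl Ω Q R W) (M : Algo n Ω L V S) : Prop :=
  ∀ (σ : List (Fin n)) (ω : ℕ → Ω) (p : Fin n), (run I M σ ω).calls p ≤ 1

/-- Group election property: in every execution in which some process calls `elect()` and all
calls of `elect()` have returned, some call has returned `win`. -/
def NotAllLose (I : Impl Ω Q R W) (M : Algo n Ω L V S) : Prop :=
  ∀ (σ : List (Fin n)) (ω : ℕ → Ω),
    (∃ p, 1 ≤ (run I M σ ω).calls p) →
    (∀ p, 1 ≤ (run I M σ ω).calls p → (run I M σ ω).result p ≠ none) →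
    ∃ p, (run I M σ ω).result p = some .win

/-- The values of all coin flips of `p` that precede the latest shared memory step of `p`. -/
def visibleFlips (h : List (Record n Ω L V R W)) (p : Fin n) : List Ω :=
  ((h.filter fun r => r.pid = p).reverse.dropWhile fun r => !r.ev.isMem).reverse.filterMap
    fun r => r.ev.coin

/-- The register that `p` accesses in its next step, if that step is a shared memory step. -/
def Config.pendingReg (c : Config n Ω L V S Q R W) (p : Fin n) : Option (L ⊕ R) :=
  match c.ctl p with
  | .codeOp op => some (.inl op.reg)
  | .methOp op _ => some (.inr op.reg)
  | _ => none

/-- The adversary's decision depends only on the past schedule, on the coin flips of each process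
preceding its latest shared memory step, and on the registers that the processes whose next step is
a shared memory step will access. -/
def RWOblivious (I : Impl Ω Q R W) (M : Algo n Ω L V S) (A : Adversary n Ω L V R W) : Prop :=
  ∀ (σ σ' : List (Fin n)) (ω ω' : ℕ → Ω),
    (run I M σ ω).hist.map (·.pid) = (run I M σ' ω').hist.map (·.pid) →
    (∀ p, visibleFlips (run I M σ ω).hist p = visibleFlips (run I M σ' ω').hist p) →
    (∀ p, (run I M σ ω).pendingReg p = (run I M σ' ω').pendingReg p) →
    A (run I M σ ω).hist = A (run I M σ' ω').hist

/-- Process `p` is poised to invoke `elect()`. -/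
def Config.Poised (M : Algo n Ω L V S) (c : Config n Ω L V S Q R W) (p : Fin n) : Prop :=
  ∃ s cont, c.ctl p = .code s ∧ M.next p s = .call cont

/-- The maximum number of processes that invoke `elect()` in an execution extending `E`. -/
noncomputable def maxContention (I : Impl Ω Q R W) (M : Algo n Ω L V S)
    (E : List (Record n Ω L V R W)) : ℕ∞ :=
  ⨆ (σ : List (Fin n)) (ω : ℕ → Ω) (_ : E <+: (run I M σ ω).hist),
    Set.encard {p | 1 ≤ (run I M σ ω).calls p}

/-- The executions that can result for `A`, that end when the first process becomes poised to invoke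
`elect()`, and that have max-contention at most `k`. -/
def Exec (I : Impl Ω Q R W) (M : Algo n Ω L V S) (A : Adversary n Ω L V R W) (k : ℕ) :
    Set (List (Record n Ω L V R W)) :=
  {E | (∃ (ω : ℕ → Ω) (t : ℕ), E = (advRun I M A ω t).hist ∧
      (∃ p, (advRun I M A ω t).Poised M p) ∧
      ∀ s < t, ∀ p, ¬ (advRun I M A ω s).Poised M p) ∧
    maxContention I M E ≤ k}

/-- The event that the random execution scheduled by `A` is an extension of `E`. -/
def extensionEvent (I : Impl Ω Q R W) (M : Algo n Ω L V S) (A : Adversary n Ω L V R W)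
    (E : List (Record n Ω L V R W)) : Set (ℕ → Ω) :=
  {ω | ∃ t, E <+: (advRun I M A ω t).hist}

/-- The number of elected processes in the (infinite) execution scheduled by `A`. -/
noncomputable def winners (I : Impl Ω Q R W) (M : Algo n Ω L V S) (A : Adversary n Ω L V R W)
    (ω : ℕ → Ω) : ℝ≥0∞ :=
  (Set.ncard {p | ∃ t, (advRun I M A ω t).result p = some .win} : ℝ≥0∞)

/-- The maximum over all processes of the number of shared memory steps made during `elect()` in the
(infinite) execution scheduled by `A`. -/
noncomputable def maxSteps (I : Impl Ω Q R W) (M : Algo n Ω L V S) (A : Adversary n Ω L V R W)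
    (ω : ℕ → Ω) : ℝ≥0∞ :=
  ⨆ (p : Fin n) (t : ℕ), ((advRun I M A ω t).steps p : ℝ≥0∞)

/-- The effectiveness of the group election implementation in algorithm `M` against `A`, where coin
flips are independent with distribution `D`. -/
noncomputable def effectiveness [MeasurableSpace Ω] (D : Measure Ω) [IsProbabilityMeasure D]
    (I : Impl Ω Q R W) (M : Algo n Ω L V S) (A : Adversary n Ω L V R W) (k : ℕ) : ℝ≥0∞ :=
  ⨆ E ∈ Exec I M A k,
    ∫⁻ ω, winners I M A ω
      ∂(cond (Measure.infinitePi fun _ : ℕ => D) (extensionEvent I M A E))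

/-- The adaptive expected max-step complexity of `elect()` in algorithm `M` against `A`. -/
noncomputable def expMaxStep [MeasurableSpace Ω] (D : Measure Ω) [IsProbabilityMeasure D]
    (I : Impl Ω Q R W) (M : Algo n Ω L V S) (A : Adversary n Ω L V R W) (k : ℕ) : ℝ≥0∞ :=
  ⨆ E ∈ Exec I M A k,
    ∫⁻ ω, maxSteps I M A ω
      ∂(cond (Measure.infinitePi fun _ : ℕ => D) (extensionEvent I M A E))

end Model

/-! The two-phase sifting algorithm. -/

/-- The registers `Up[i]` and `Down[i]`; they store `0` or `1` (`false` or `true`). -/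
inductive SiftReg
  | up (i : ℕ)
  | down (i : ℕ)

/-- Local states of the sifting algorithm: about to choose `c_i` in the backward sifting phase, or
about to choose `c'_i` in the forward sifting phase. -/
inductive SiftState
  | backward (i : ℕ)
  | forward (i : ℕ)

/-- The test of the loop `while i > 1` of the forward sifting phase. -/
def siftLoop (i : ℕ) : SiftState ⊕ Outcome :=
  if 1 < i then .inl (.forward (i - 1)) else .inr .win

open Classical in
/-- The two-phase sifting algorithm with arrays `Up[1..ℓ]` and `Down[1..ℓ-1]`. The choice in round
`i` is heads if the coin flip lies in `H i`. -/
noncomputable def sift {Ω : Type*} (ℓ : ℕ) (H : ℕ → Set Ω) : Impl Ω SiftState SiftReg Bool where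
  start := .backward 1
  init _ := false
  act
    | .backward i, w =>
      if w ∈ H i then
        .write (.up i) true (if i = ℓ then siftLoop i else .inl (.backward (i + 1)))
      else
        .read (.up i) fun v => if v = true then .inr .lose else siftLoop i
    | .forward i, w =>
      if w ∈ H i then
        .write (.down i) true (siftLoop i)
      else
        .read (.down i) fun v => if v = true then .inr .lose else siftLoop i

/-- The probability of heads in round `i ≥ 1`. -/
noncomputable def headsProb (i : ℕ) : ℝ := 1 / 2 ^ ((3 / 2 : ℝ) ^ (i - 1))

/-- `ℓ = ⌈log_{3/2} log₂ n⌉`. This is at least `2` for `n ≥ 3`; for `n ≤ 2`, where the formula gives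
no nonempty array `Up[1..ℓ]`, we put `ℓ = 1`. -/
noncomputable def arrayLen (n : ℕ) : ℕ := max 1 ⌈Real.logb (3 / 2) (Real.logb 2 n)⌉₊

end GroupElect

/-!
The register that a process accesses next in `elect()` does not depend on its latest coin flip,
which only decides between a read and a write and which an r/w-oblivious adversary cannot see until
the access is made. So this flip may be resampled just before the access, and a potential that does
not increase in expectation over each access with a fresh coin bounds the corresponding expectation
over the whole execution.

* Winners: charge a process with the probability that it wins by writing in all rounds, and an
  unwritten register of round `i` with `q₁ ⋯ qᵢ₋₁ / qᵢ`, since at most `1 / qᵢ` processes are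
  expected to read it before it is written, and each of them then wins by writing only with
  probability `q₁ ⋯ qᵢ₋₁`. As `q₁ ⋯ qᵢ₋₁ / qᵢ = 4 qᵢ`, all registers together cost at most `14`, and
  the writers in all rounds at most `2`.
* Steps: a process in round `i` of the backward phase has written `Up[1], …, Up[i - 1]`, and each
  round takes it at most one step per phase, so `1 + 2 · #{i < ℓ : Up[i] is written}` bounds the
  number of steps of every process. The probability that `Up[i]` is written is at most
  `k q₁ ⋯ qᵢ`, which decreases geometrically once `i` exceeds `log_{3/2} log₂ k`.
* Some process wins: among the processes that are farthest on their way, the last one to move cannot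
  read a `1` in the register of its round.
-/

namespace GroupElect

open MeasureTheory ProbabilityTheory
open scoped ENNReal

section Step

variable {n : ℕ} {Ω L V S Q R W : Type*} {I : Impl Ω Q R W} (M : Algo n Ω L V S)
  (c : Config n Ω L V S Q R W)

/-- Replace the control state of `p` and the recorded execution. -/
def Config.modify (c : Config n Ω L V S Q R W) (p : Fin n) (x : Ctl L V S Q R W)
    (h : List (Record n Ω L V R W)) : Config n Ω L V S Q R W :=
  { c with ctl := Function.update c.ctl p x, hist := h }

theorem Config.step_modify {p p' : Fin n} (hp : p' ≠ p) (x : Ctl L V S Q R W) (w : Ω) :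
    ∃ e : Event Ω L V R W, (c.step I M p' w).hist = c.hist ++ [⟨p', e⟩] ∧
      ∀ h, (c.modify p x h).step I M p' w =
        (c.step I M p' w).modify p x (h ++ [⟨p', e⟩]) := by
  have hx : ∀ h, (c.modify p x h).ctl p' = c.ctl p' := fun h => by simp [Config.modify, hp]
  have hu : ∀ y, Function.update (Function.update c.ctl p x) p' y =
      Function.update (Function.update c.ctl p' y) p x :=
    fun y => Function.update_comm hp.symm _ _ _
  simp only [Config.step, hx]
  rcases c.ctl p' with s | (⟨y, k⟩ | ⟨y, v, s⟩) | ⟨q, cont⟩ | ⟨(⟨y, k⟩ | ⟨y, v, r⟩), cont⟩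
  · rcases hs : M.next p' s with _ | op | cont <;> simp only [hs]
    · exact ⟨.noop, rfl, fun h => rfl⟩
    · exact ⟨.flip w, rfl, fun h => by simp [Config.modify, Config.log, Config.goto, hu]⟩
    · exact ⟨.flip w, rfl, fun h => by simp [Config.modify, Config.log, Config.goto, hu]⟩
  · exact ⟨.read (.inl y) (.inl (c.mem y)), rfl,
      fun h => by simp [Config.modify, Config.log, Config.goto, hu]⟩
  · exact ⟨.write (.inl y) (.inl v), rfl,
      fun h => by simp [Config.modify, Config.log, Config.goto, hu]⟩
  · exact ⟨.flip w, rfl, fun h => by simp [Config.modify, Config.log, Config.goto, hu]⟩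
  · refine ⟨.read (.inr y) (.inr (c.gmem y)), ?_, fun h => ?_⟩ <;>
    rcases hr : k (c.gmem y) with q | o <;>
    simp [Config.modify, Config.resume, Config.log, Config.goto, hu, hr]
  · refine ⟨.write (.inr y) (.inr v), ?_, fun h => ?_⟩ <;>
    rcases r with q | o <;>
    simp [Config.modify, Config.resume, Config.log, Config.goto, hu]

theorem Config.modify_self (p : Fin n) : c.modify p (c.ctl p) c.hist = c := by
  simp [Config.modify]

theorem Config.step_ctl_of_ne {p p' : Fin n} (w : Ω) (hp : p ≠ p') :
    (c.step I M p' w).ctl p = c.ctl p := by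
  obtain ⟨e, -, h⟩ := c.step_modify (I := I) M hp.symm (c.ctl p) w
  rw [← c.modify_self p, h]
  simp [Config.modify]

theorem Config.step_coin (p : Fin n) :
    (∀ w, (c.step I M p w).hist = c.hist ++ [⟨p, .flip w⟩]) ∨
      (∃ e : Event Ω L V R W, ∀ w, (c.step I M p w).hist = c.hist ++ [⟨p, e⟩]) ∧
        ∀ w w', c.step I M p w = c.step I M p w' := by
  simp only [Config.step]
  rcases c.ctl p with s | (⟨x, k⟩ | ⟨x, v, s⟩) | ⟨q, cont⟩ | ⟨(⟨x, k⟩ | ⟨x, v, r⟩), cont⟩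
  · rcases hs : M.next p s with _ | op | cont <;> simp only [hs]
    · exact Or.inr ⟨⟨.noop, fun _ => rfl⟩, fun _ _ => trivial⟩
    · exact Or.inl fun _ => rfl
    · exact Or.inl fun _ => rfl
  · exact Or.inr ⟨⟨_, fun _ => rfl⟩, fun _ _ => rfl⟩
  · exact Or.inr ⟨⟨_, fun _ => rfl⟩, fun _ _ => rfl⟩
  · exact Or.inl fun _ => rfl
  · refine Or.inr ⟨⟨.read (.inr x) (.inr (c.gmem x)), fun _ => ?_⟩, fun _ _ => rfl⟩
    rcases hr : k (c.gmem x) with _ | _ <;> simp [Config.resume, Config.log, Config.goto, hr]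
  · refine Or.inr ⟨⟨.write (.inr x) (.inr v), fun _ => ?_⟩, fun _ _ => rfl⟩
    rcases r with _ | _ <;> simp [Config.resume, Config.log, Config.goto]

theorem Config.exists_step_hist (p : Fin n) (w : Ω) :
    ∃ e : Event Ω L V R W, (c.step I M p w).hist = c.hist ++ [⟨p, e⟩] := by
  rcases c.step_coin (I := I) M p with h | ⟨⟨e, h⟩, -⟩
  exacts [⟨_, h w⟩, ⟨e, h w⟩]

theorem Config.flips_step_of_hist {c' : Config n Ω L V S Q R W} {p : Fin n} {e : Event Ω L V R W}
    (h : c'.hist = c.hist ++ [⟨p, e⟩]) : c'.flips = c.flips + e.coin.toList.length := by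
  rcases e <;> simp [Config.flips, h, Event.coin]

theorem Config.flips_le_flips_step (p : Fin n) (w : Ω) : c.flips ≤ (c.step I M p w).flips := by
  obtain ⟨e, he⟩ := c.exists_step_hist (I := I) M p w
  simp [Config.flips, he]

theorem Config.step_eq_modify_of_methOp {M : Algo n Ω L V S} {c : Config n Ω L V S Q R W}
    {p : Fin n} {w : Ω} {op : Op R W (Q ⊕ Outcome)} {cont : Outcome → S}
    (h : (c.step I M p w).ctl p = .methOp op cont) :
    ∃ q, (∀ w', c.step I M p w' =
      (c.step I M p w).modify p (.methOp (I.act q w') cont) (c.hist ++ [⟨p, .flip w'⟩])) ∧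
      op = I.act q w := by
  simp only [Config.step] at h ⊢
  rcases hc : c.ctl p with s | (⟨x, k⟩ | ⟨x, v, s⟩) | ⟨q, k⟩ | ⟨(⟨x, k⟩ | ⟨x, v, r⟩), k'⟩ <;>
    simp only [hc] at h
  · rcases hs : M.next p s with _ | op | k <;> simp only [hs] at h
    · simp [Config.log, hc] at h
    · simp [Config.log, Config.goto] at h
    · simp only [Config.log, Config.goto, Function.update_self, Ctl.methOp.injEq] at h
      exact ⟨I.start, fun w' => by simp [hs, Config.modify, Config.log, Config.goto, h.2],
        h.1.symm⟩
  · simp [Config.log, Config.goto] at h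
  · simp [Config.log, Config.goto] at h
  · simp only [Config.log, Config.goto, Function.update_self, Ctl.methOp.injEq] at h
    exact ⟨q, fun w' => by simp [Config.modify, Config.log, Config.goto, h.2], h.1.symm⟩
  · rcases hr : k (c.gmem x) with q | o <;>
      simp [Config.resume, Config.log, Config.goto, hr] at h
  · rcases r with q | o <;> simp [Config.resume, Config.log, Config.goto] at h

end Step

section View

variable {n : ℕ} {Ω L V S Q R W : Type*} {reg : Q → R} {I : Impl Ω Q R W} {M : Algo n Ω L V S}

open Classical in
/-- The outcome of a shared memory step when the registers hold `g`, with the new contents of the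
registers. -/
noncomputable def Op.apply {X Y T : Type*} (g : X → Y) : Op X Y T → T × (X → Y)
  | .read x cont => (cont (g x), g)
  | .write x v next => (next, Function.update g x v)

/-- The register accessed by `elect()` in local state `q` is `reg q`, whatever the coin flip; the
coin then decides only between reading and writing, which an r/w-oblivious adversary cannot see. -/
def Impl.Accesses (I : Impl Ω Q R W) (reg : Q → R) : Prop :=
  ∀ q w, (I.act q w).reg = reg q

/-- The register that a process inside `elect()` accesses next. -/
def Ctl.electReg (reg : Q → R) : Ctl L V S Q R W → Option R
  | .meth q _ => some (reg q)
  | .methOp op _ => some op.reg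
  | _ => none

/-- The part of a configuration that concerns the group election object. `reg p` is the register
that `p` accesses next if `p` is inside `elect()`; a coin flip inside `elect()` leaves the view
unchanged. -/
structure View (n : ℕ) (R W : Type*) where
  gmem : R → W
  reg : Fin n → Option R
  calls : Fin n → ℕ
  steps : Fin n → ℕ
  result : Fin n → Option Outcome

/-- The view of a configuration; `reg q` is the register accessed in local state `q`. -/
def Config.view (reg : Q → R) (c : Config n Ω L V S Q R W) : View n R W where
  gmem := c.gmem
  reg p := (c.ctl p).electReg reg
  calls := c.calls
  steps := c.steps
  result := c.result

/-- The view of the empty execution. -/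
def View.initial (n : ℕ) (I : Impl Ω Q R W) : View n R W where
  gmem := I.init
  reg _ := none
  calls _ := 0
  steps _ := 0
  result _ := none

/-- The effect on the view of an invocation of `elect()` by `p`, whose first access is to `x`. -/
def View.invoke (v : View n R W) (p : Fin n) (x : R) : View n R W :=
  { v with
    reg := Function.update v.reg p (some x)
    calls := Function.update v.calls p (v.calls p + 1) }

/-- The effect on the view of a shared memory step of `p` inside `elect()`. -/
noncomputable def View.access (v : View n R W) (reg : Q → R) (p : Fin n)
    (op : Op R W (Q ⊕ Outcome)) : View n R W :=
  { v with
    gmem := (op.apply v.gmem).2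
    reg := Function.update v.reg p ((op.apply v.gmem).1.elim (some ∘ reg) fun _ => none)
    steps := Function.update v.steps p (v.steps p + 1)
    result := Function.update v.result p ((op.apply v.gmem).1.elim (fun _ => v.result p) some) }

theorem Config.view_goto (c : Config n Ω L V S Q R W) (p : Fin n) (x : Ctl L V S Q R W) :
    (c.goto p x).view reg =
      { c.view reg with reg := Function.update (c.view reg).reg p (x.electReg reg) } := by
  simp only [Config.view, Config.goto, View.mk.injEq, true_and, and_true]
  exact (Function.comp_update (Ctl.electReg reg) c.ctl p x)

theorem Config.view_goto_of_electReg_eq (c : Config n Ω L V S Q R W) {p : Fin n}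
    {x : Ctl L V S Q R W} (hx : x.electReg reg = (c.ctl p).electReg reg) :
    (c.goto p x).view reg = c.view reg := by
  rw [c.view_goto, hx]
  exact congrArg (fun f => { c.view reg with reg := f }) (Function.update_eq_self p _)

theorem Config.view_resume (c : Config n Ω L V S Q R W) (p : Fin n) (cont : Outcome → S)
    (r : Q ⊕ Outcome) :
    (c.resume p cont r).view reg =
      { c.view reg with
        reg := Function.update (c.view reg).reg p (r.elim (some ∘ reg) fun _ => none)
        steps := Function.update c.steps p (c.steps p + 1)
        result := Function.update c.result p (r.elim (fun _ => c.result p) some) } := by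
  rcases r with q | o
  · have h := c.view_goto (reg := reg) p (.meth q cont)
    simp_all [Config.view, Config.resume, Config.goto, Ctl.electReg]
  · have h := c.view_goto (reg := reg) p (.code (cont o))
    simp_all [Config.view, Config.resume, Config.goto, Ctl.electReg]

theorem Config.view_step_of_methOp {c : Config n Ω L V S Q R W} {p : Fin n}
    {op : Op R W (Q ⊕ Outcome)} {cont : Outcome → S} (hc : c.ctl p = .methOp op cont) (w : Ω) :
    (c.step I M p w).view reg = (c.view reg).access reg p op := by
  simp only [Config.step, hc]
  rcases op with ⟨x, k⟩ | ⟨x, v, r⟩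
  · exact c.view_resume p cont _
  · exact congrArg (fun v' : View n R W => { v' with gmem := (Op.write x v r |>.apply c.gmem).2 })
      (c.view_resume p cont r)

theorem Config.view_step (hreg : I.Accesses reg) (M : Algo n Ω L V S)
    (c : Config n Ω L V S Q R W) (p : Fin n) (w : Ω) :
    (c.step I M p w).view reg = c.view reg ∨
      c.Poised M p ∧ (c.step I M p w).view reg = (c.view reg).invoke p (reg I.start) ∨
      ∃ op cont, c.ctl p = .methOp op cont ∧
        (c.step I M p w).view reg = (c.view reg).access reg p op := by
  rcases hc : c.ctl p with s | op | ⟨q, cont⟩ | ⟨op, cont⟩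
  · rcases hs : M.next p s with _ | op | cont <;> simp only [Config.step, hc, hs]
    · exact Or.inl rfl
    · exact Or.inl (c.view_goto_of_electReg_eq (by rw [hc]; rfl))
    · refine Or.inr (Or.inl ⟨⟨s, cont, hc, hs⟩, ?_⟩)
      have h := c.view_goto (reg := reg) p (.methOp (I.act I.start w) cont)
      simp_all [Config.view, Config.log, View.invoke, Ctl.electReg, Impl.Accesses]
  · left
    rcases op <;> simp only [Config.step, hc] <;>
      exact c.view_goto_of_electReg_eq (by rw [hc]; rfl)
  · simp only [Config.step, hc]
    exact Or.inl (c.view_goto_of_electReg_eq (by simp [hc, Ctl.electReg, hreg q w]))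
  · exact Or.inr (Or.inr ⟨op, cont, rfl, Config.view_step_of_methOp hc w⟩)

theorem Config.Poised.view_reg {c : Config n Ω L V S Q R W} {p : Fin n} (h : c.Poised M p) :
    (c.view reg).reg p = none := by
  obtain ⟨s, cont, hs, -⟩ := h
  simp [Config.view, hs, Ctl.electReg]

theorem Config.view_reg_of_methOp {c : Config n Ω L V S Q R W} {p : Fin n}
    {op : Op R W (Q ⊕ Outcome)} {cont : Outcome → S} (h : c.ctl p = .methOp op cont) :
    (c.view reg).reg p = some op.reg := by
  simp [Config.view, h, Ctl.electReg]

end View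

section Run

variable {n : ℕ} {Ω L V S Q R W : Type*} {reg : Q → R} {I : Impl Ω Q R W} {M : Algo n Ω L V S}

theorem run_append (σ : List (Fin n)) (p : Fin n) (ω : ℕ → Ω) :
    run I M (σ ++ [p]) ω = (run I M σ ω).step I M p (ω (run I M σ ω).flips) := by
  simp [run]

theorem exists_act_of_ctl_methOp (σ : List (Fin n)) (ω : ℕ → Ω) {p : Fin n}
    {op : Op R W (Q ⊕ Outcome)} {cont : Outcome → S}
    (h : (run I M σ ω).ctl p = .methOp op cont) : ∃ q w, op = I.act q w := by
  induction σ using List.reverseRecOn with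
  | nil => simp [run, Config.initial] at h
  | append_singleton σ p' ih =>
    rw [run_append] at h
    by_cases hp : p = p'
    · subst hp
      obtain ⟨q, -, hq⟩ := Config.step_eq_modify_of_methOp h
      exact ⟨q, _, hq⟩
    · exact ih (Config.step_ctl_of_ne M _ _ hp ▸ h)

/-- The progress of the `elect()` call of `p`, when `p` makes at most one such call. -/
inductive View.Status (v : View n R W) (p : Fin n) : Prop
  | fresh (reg_eq : v.reg p = none) (calls_eq : v.calls p = 0) (steps_eq : v.steps p = 0)
      (result_eq : v.result p = none)
  | running (x : R) (reg_eq : v.reg p = some x) (calls_eq : v.calls p = 1)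
      (result_eq : v.result p = none)
  | returned (o : Outcome) (reg_eq : v.reg p = none) (calls_eq : v.calls p = 1)
      (result_eq : v.result p = some o)

theorem View.Status.invoke {v : View n R W} {p p' : Fin n} {x : R} (h : v.Status p)
    (hp' : v.reg p' = none) (hcalls : (v.invoke p' x).calls p ≤ 1) :
    (v.invoke p' x).Status p := by
  by_cases hp : p = p'
  · subst hp
    simp only [View.invoke, Function.update_self] at hcalls
    rcases h with ⟨-, hc, -, hr⟩ | ⟨y, hy, -, -⟩ | ⟨_, -, hc, -⟩
    · exact .running x (by simp [View.invoke]) (by simp [View.invoke, hc]) hr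
    · simp [hy] at hp'
    · omega
  · rcases h with ⟨hy, hc, hs, hr⟩ | ⟨y, hy, hc, hr⟩ | ⟨o, hy, hc, hr⟩
    · exact .fresh (by simpa [View.invoke, hp]) (by simpa [View.invoke, hp]) hs hr
    · exact .running y (by simpa [View.invoke, hp]) (by simpa [View.invoke, hp]) hr
    · exact .returned o (by simpa [View.invoke, hp]) (by simpa [View.invoke, hp]) hr

theorem View.Status.access {v : View n R W} {p p' : Fin n} {x : R} (h : v.Status p)
    (hp' : v.reg p' = some x) (op : Op R W (Q ⊕ Outcome)) : (v.access reg p' op).Status p := by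
  by_cases hp : p = p'
  · subst hp
    rcases h with ⟨hy, -, -, -⟩ | ⟨_, -, hc, hr⟩ | ⟨_, hy, -, -⟩
    · simp [hy] at hp'
    · rcases hop : (op.apply v.gmem).1 with q | o
      · exact .running (reg q) (by simp [View.access, hop]) hc (by simpa [View.access, hop])
      · exact .returned o (by simp [View.access, hop]) hc (by simp [View.access, hop])
    · simp [hy] at hp'
  · rcases h with ⟨hy, hc, hs, hr⟩ | ⟨y, hy, hc, hr⟩ | ⟨o, hy, hc, hr⟩
    · exact .fresh (by simpa [View.access, hp]) hc (by simpa [View.access, hp])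
        (by simpa [View.access, hp])
    · exact .running y (by simpa [View.access, hp]) hc (by simpa [View.access, hp])
    · exact .returned o (by simpa [View.access, hp]) hc (by simpa [View.access, hp])

theorem OneTime.status (hM : OneTime I M) (hreg : I.Accesses reg) (σ : List (Fin n)) (ω : ℕ → Ω)
    (p : Fin n) : ((run I M σ ω).view reg).Status p := by
  induction σ using List.reverseRecOn with
  | nil => exact .fresh rfl rfl rfl rfl
  | append_singleton σ p' ih =>
    have hcalls := hM (σ ++ [p']) ω p
    change ((run I M (σ ++ [p']) ω).view reg).calls p ≤ 1 at hcalls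
    rw [run_append] at hcalls ⊢
    rcases (run I M σ ω).view_step hreg M p' (ω (run I M σ ω).flips) with
      h | ⟨hpoised, h⟩ | ⟨op, cont, hctl, h⟩ <;> rw [h] at hcalls ⊢
    · exact ih
    · exact ih.invoke hpoised.view_reg hcalls
    · exact ih.access (Config.view_reg_of_methOp hctl) op

/-- The possible changes of the view in one step of a one-time algorithm. -/
inductive View.Next (I : Impl Ω Q R W) (reg : Q → R) (v : View n R W) : View n R W → Prop
  | unchanged : View.Next I reg v v
  | invoke (p : Fin n) (reg_eq : v.reg p = none) (calls_eq : v.calls p = 0)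
      (steps_eq : v.steps p = 0) : View.Next I reg v (v.invoke p (reg I.start))
  | access (p : Fin n) (q : Q) (w : Ω) (reg_eq : v.reg p = some (reg q))
      (result_eq : v.result p = none) : View.Next I reg v (v.access reg p (I.act q w))

theorem OneTime.view_next (hM : OneTime I M) (hreg : I.Accesses reg) (σ : List (Fin n)) (p : Fin n)
    (ω : ℕ → Ω) :
    View.Next I reg ((run I M σ ω).view reg) ((run I M (σ ++ [p]) ω).view reg) := by
  have hstatus := hM.status hreg σ ω p
  have hcalls := hM (σ ++ [p]) ω p
  change ((run I M (σ ++ [p]) ω).view reg).calls p ≤ 1 at hcalls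
  rw [run_append] at hcalls ⊢
  rcases (run I M σ ω).view_step hreg M p (ω (run I M σ ω).flips) with
    h | ⟨hpoised, h⟩ | ⟨op, cont, hctl, h⟩ <;> rw [h] at hcalls ⊢
  · exact .unchanged
  · simp only [View.invoke, Function.update_self] at hcalls
    rcases hstatus with ⟨hx, hc, hs, -⟩ | ⟨x, hx, -, -⟩ | ⟨_, -, hc, -⟩
    · exact .invoke p hx hc hs
    · simp [hpoised.view_reg] at hx
    · omega
  · obtain ⟨q, w, rfl⟩ := exists_act_of_ctl_methOp σ ω hctl
    have hx := Config.view_reg_of_methOp (reg := reg) hctl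
    rcases hstatus with ⟨hy, -, -, -⟩ | ⟨_, -, -, hr⟩ | ⟨_, hy, -, -⟩
    · simp [hy] at hx
    · exact .access p q w (by rw [hx, hreg q w]) hr
    · simp [hy] at hx

theorem OneTime.view_induction (hM : OneTime I M) (hreg : I.Accesses reg) {P : View n R W → Prop}
    (initial : P (View.initial n I)) (next : ∀ v v', View.Next I reg v v' → P v → P v')
    (σ : List (Fin n)) (ω : ℕ → Ω) : P ((run I M σ ω).view reg) := by
  induction σ using List.reverseRecOn with
  | nil => exact initial
  | append_singleton σ p ih => exact next _ _ (hM.view_next hreg σ p ω) ih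

theorem View.Next.result_mono {v v' : View n R W} (h : View.Next I reg v v') {p : Fin n}
    {o : Outcome} (hp : v.result p = some o) : v'.result p = some o := by
  rcases h with _ | ⟨p', -, -, -⟩ | ⟨p', q, w, -, hr⟩
  · exact hp
  · exact hp
  · have hne : p ≠ p' := by rintro rfl; simp [hp] at hr
    simpa [View.access, hne]

end Run

section AdversarialRun

variable {n : ℕ} {Ω L V S Q R W : Type*} {I : Impl Ω Q R W} {M : Algo n Ω L V S}
  {A : Adversary n Ω L V R W} {reg : Q → R}

theorem exists_run_eq_advRun (ω : ℕ → Ω) (t : ℕ) : ∃ σ, run I M σ ω = advRun I M A ω t := by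
  induction t with
  | zero => exact ⟨[], rfl⟩
  | succ t ih =>
    obtain ⟨σ, hσ⟩ := ih
    exact ⟨σ ++ [A (advRun I M A ω t).hist], by rw [run_append, hσ, advRun]⟩

theorem exists_hist_advRun_succ (ω : ℕ → Ω) (t : ℕ) :
    ∃ r, (advRun I M A ω (t + 1)).hist = (advRun I M A ω t).hist ++ [r] :=
  let ⟨_, he⟩ := Config.exists_step_hist M (advRun I M A ω t) _ _
  ⟨_, he⟩

theorem length_hist_advRun (ω : ℕ → Ω) (t : ℕ) : (advRun I M A ω t).hist.length = t := by
  induction t with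
  | zero => rfl
  | succ t ih =>
    obtain ⟨r, hr⟩ := exists_hist_advRun_succ (I := I) (M := M) (A := A) ω t
    simp [hr, ih]

theorem hist_advRun_prefix (ω : ℕ → Ω) {s t : ℕ} (hst : s ≤ t) :
    (advRun I M A ω s).hist <+: (advRun I M A ω t).hist := by
  induction t, hst using Nat.le_induction with
  | base => exact List.prefix_rfl
  | succ t _ ih =>
    obtain ⟨r, hr⟩ := exists_hist_advRun_succ (I := I) (M := M) (A := A) ω t
    exact hr ▸ ih.trans (List.prefix_append _ _)

theorem eq_hist_advRun_of_prefix {ω : ℕ → Ω} {E : List (Record n Ω L V R W)} {t : ℕ}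
    (h : E <+: (advRun I M A ω t).hist) : (advRun I M A ω E.length).hist = E := by
  have hle : E.length ≤ t := by simpa [length_hist_advRun] using h.length_le
  have hprefix := List.prefix_of_prefix_length_le h (hist_advRun_prefix ω hle)
    (by rw [length_hist_advRun])
  exact (hprefix.eq_of_length (by rw [length_hist_advRun])).symm

theorem flips_advRun_mono (ω : ℕ → Ω) : Monotone fun t => (advRun I M A ω t).flips :=
  monotone_nat_of_le_succ fun _ => Config.flips_le_flips_step ..

theorem flips_advRun_le (ω : ℕ → Ω) (t : ℕ) : (advRun I M A ω t).flips ≤ t := by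
  conv_rhs => rw [← length_hist_advRun (I := I) (M := M) (A := A) ω t]
  exact List.length_filterMap_le _ _

theorem advRun_eq_of_hist_eq {ω ω' : ℕ → Ω} {t : ℕ}
    (h : (advRun I M A ω t).hist = (advRun I M A ω' t).hist) :
    advRun I M A ω t = advRun I M A ω' t := by
  induction t with
  | zero => rfl
  | succ t ih =>
    have hprefix := h ▸ hist_advRun_prefix ω t.le_succ
    have hhist := eq_hist_advRun_of_prefix hprefix
    rw [length_hist_advRun] at hhist
    rw [advRun, advRun, ← ih hhist.symm] at h ⊢
    rcases (advRun I M A ω t).step_coin (I := I) M (A (advRun I M A ω t).hist) with hflip | ⟨-, heq⟩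
    · simp only [hflip, List.append_cancel_left_eq, List.cons.injEq, Record.mk.injEq,
        Event.flip.injEq, true_and, and_true] at h
      rw [h]
    · exact heq _ _

theorem advRun_congr {ω ω' : ℕ → Ω} {t : ℕ} (h : ∀ i < (advRun I M A ω t).flips, ω i = ω' i) :
    advRun I M A ω t = advRun I M A ω' t := by
  induction t with
  | zero => rfl
  | succ t ih =>
    rw [advRun, advRun, ← ih fun i hi => h i (hi.trans_le (flips_advRun_mono ω t.le_succ))]
    rcases (advRun I M A ω t).step_coin (I := I) M (A (advRun I M A ω t).hist) with hflip | ⟨-, heq⟩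
    · rw [h]
      rw [advRun, Config.flips_step_of_hist _ (hflip _)]
      simp [Event.coin]
    · exact heq _ _

theorem OneTime.view_advRun_next (hM : OneTime I M) (hreg : I.Accesses reg) (ω : ℕ → Ω) (t : ℕ) :
    View.Next I reg ((advRun I M A ω t).view reg) ((advRun I M A ω (t + 1)).view reg) := by
  obtain ⟨σ, hσ⟩ := exists_run_eq_advRun (I := I) (M := M) (A := A) ω t
  rw [advRun, ← hσ, ← run_append]
  exact hM.view_next hreg σ _ ω

theorem OneTime.view_advRun_mono (hM : OneTime I M) (hreg : I.Accesses reg)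
    {P : View n R W → Prop} (hP : ∀ v v', View.Next I reg v v' → P v → P v') (ω : ℕ → Ω)
    {s t : ℕ} (hst : s ≤ t) (h : P ((advRun I M A ω s).view reg)) :
    P ((advRun I M A ω t).view reg) := by
  induction t, hst using Nat.le_induction with
  | base => exact h
  | succ t _ ih => exact hP _ _ (hM.view_advRun_next hreg ω t) ih

theorem view_advRun_of_not_poised (hreg : I.Accesses reg) {ω : ℕ → Ω} {t : ℕ}
    (h : ∀ s < t, ∀ p, ¬ (advRun I M A ω s).Poised M p) :
    (advRun I M A ω t).view reg = View.initial n I := by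
  induction t with
  | zero => rfl
  | succ t ih =>
    specialize ih fun s hs => h s (hs.trans t.lt_succ_self)
    rcases (advRun I M A ω t).view_step hreg M (A (advRun I M A ω t).hist)
      (ω (advRun I M A ω t).flips) with hview | ⟨hpoised, -⟩ | ⟨op, cont, hctl, -⟩
    · rw [advRun, hview, ih]
    · exact absurd hpoised (h t t.lt_succ_self _)
    · have := Config.view_reg_of_methOp (reg := reg) hctl
      simp [ih, View.initial] at this

end AdversarialRun

section HiddenFlip

variable {n : ℕ} {Ω L V S Q R W : Type*} {I : Impl Ω Q R W} {M : Algo n Ω L V S}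
  {A : Adversary n Ω L V R W} {reg : Q → R} {c c' : Config n Ω L V S Q R W} {p : Fin n} {q : Q}
  {w w' : Ω}

/-- The number of coin flips made (by all processes) before the latest step of `p`; if that step is
a coin flip, this is its index in the coin flip vector. -/
def flipIndex (p : Fin n) (h : List (Record n Ω L V R W)) : ℕ :=
  ((h.reverse.dropWhile fun r => r.pid ≠ p).tail.filterMap fun r => r.ev.coin).length

theorem flipIndex_append_cons {h₁ : List (Record n Ω L V R W)} (hpid : ∀ r ∈ h₁, r.pid ≠ p)
    (h₀ : List (Record n Ω L V R W)) (e : Event Ω L V R W) :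
    flipIndex p (h₀ ++ ⟨p, e⟩ :: h₁) = (h₀.filterMap fun r => r.ev.coin).length := by
  have hdrop : (h₀ ++ ⟨p, e⟩ :: h₁).reverse.dropWhile (fun r => r.pid ≠ p) =
      ⟨p, e⟩ :: h₀.reverse := by
    rw [List.reverse_append, List.reverse_cons, List.append_assoc,
      List.dropWhile_append_of_pos (by simpa using hpid)]
    simp
  rw [flipIndex, hdrop, List.tail_cons, List.filterMap_reverse, List.length_reverse]

theorem flipIndex_concat_of_ne {p' : Fin n} (hp : p' ≠ p) (h : List (Record n Ω L V R W))
    (e : Event Ω L V R W) : flipIndex p (h ++ [⟨p', e⟩]) = flipIndex p h := by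
  simp [flipIndex, hp]

/-- `c'` arises from `c` by changing from `w` to `w'` the result of the coin flip that `p` made in
local state `q` of `elect()` and that determines the pending shared memory step of `p`. -/
inductive FlipVariant (I : Impl Ω Q R W) (p : Fin n) (q : Q) (w w' : Ω)
    (c : Config n Ω L V S Q R W) : Config n Ω L V S Q R W → Prop
  | intro (h₀ h₁ : List (Record n Ω L V R W)) (cont : Outcome → S)
      (ctl_eq : c.ctl p = .methOp (I.act q w) cont) (hist_eq : c.hist = h₀ ++ ⟨p, .flip w⟩ :: h₁)
      (pid_ne : ∀ r ∈ h₁, r.pid ≠ p) :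
      FlipVariant I p q w w' c
        (c.modify p (.methOp (I.act q w') cont) (h₀ ++ ⟨p, .flip w'⟩ :: h₁))

namespace FlipVariant

theorem flips_eq (h : FlipVariant I p q w w' c c') : c'.flips = c.flips := by
  rcases h with ⟨h₀, h₁, cont, -, hist_eq, -⟩
  simp [Config.flips, Config.modify, hist_eq, Event.coin]

theorem flipIndex_eq (h : FlipVariant I p q w w' c c') :
    flipIndex p c'.hist = flipIndex p c.hist := by
  rcases h with ⟨h₀, h₁, cont, -, hist_eq, pid_ne⟩
  simp [Config.modify, hist_eq, flipIndex_append_cons pid_ne]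

theorem flipIndex_lt_flips (h : FlipVariant I p q w w' c c') : flipIndex p c.hist < c.flips := by
  rcases h with ⟨h₀, h₁, cont, -, hist_eq, pid_ne⟩
  simp [Config.flips, hist_eq, flipIndex_append_cons pid_ne, Event.coin]

theorem view_eq (h : FlipVariant I p q w w' c c') (hreg : I.Accesses reg) :
    c'.view reg = c.view reg := by
  rcases h with ⟨h₀, h₁, cont, ctl_eq, -, -⟩
  exact c.view_goto_of_electReg_eq (by simp [ctl_eq, Ctl.electReg, hreg q _])

theorem exists_ctl_eq (h : FlipVariant I p q w w' c c') :
    ∃ op cont, c'.ctl p = .methOp op cont := by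
  rcases h with ⟨h₀, h₁, cont, -, -, -⟩
  exact ⟨_, cont, Function.update_self ..⟩

theorem view_reg_eq (h : FlipVariant I p q w w' c c') (hreg : I.Accesses reg) :
    (c.view reg).reg p = some (reg q) := by
  rcases h with ⟨h₀, h₁, cont, ctl_eq, -, -⟩
  rw [Config.view_reg_of_methOp ctl_eq, hreg]

theorem view_step (h : FlipVariant I p q w w' c c') (hreg : I.Accesses reg) (w₁ : Ω) :
    (c'.step I M p w₁).view reg = (c.view reg).access reg p (I.act q w') := by
  rw [← h.view_eq hreg]
  rcases h with ⟨h₀, h₁, cont, -, -, -⟩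
  exact Config.view_step_of_methOp (Function.update_self ..) w₁

theorem map_pid_eq (h : FlipVariant I p q w w' c c') :
    c'.hist.map (·.pid) = c.hist.map (·.pid) := by
  rcases h with ⟨h₀, h₁, cont, -, hist_eq, -⟩
  simp [Config.modify, hist_eq]

theorem visibleFlips_eq (h : FlipVariant I p q w w' c c') (p' : Fin n) :
    visibleFlips c'.hist p' = visibleFlips c.hist p' := by
  rcases h with ⟨h₀, h₁, cont, -, hist_eq, pid_ne⟩
  by_cases hp : p = p'
  · subst hp
    have hfilter : h₁.filter (fun r => r.pid = p) = [] := by simpa using pid_ne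
    simp [Config.modify, hist_eq, visibleFlips, hfilter, Event.isMem]
  · simp [Config.modify, hist_eq, visibleFlips, hp]

theorem pendingReg_eq (h : FlipVariant I p q w w' c c') (hreg : I.Accesses reg) (p' : Fin n) :
    c'.pendingReg p' = c.pendingReg p' := by
  rcases h with ⟨h₀, h₁, cont, ctl_eq, -, -⟩
  by_cases hp : p' = p
  · subst hp
    simp [Config.pendingReg, Config.modify, ctl_eq, hreg q _]
  · simp [Config.pendingReg, Config.modify, hp]

theorem step {p' : Fin n} (h : FlipVariant I p q w w' c c') (hp : p' ≠ p) (w₁ : Ω) :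
    FlipVariant I p q w w' (c.step I M p' w₁) (c'.step I M p' w₁) := by
  rcases h with ⟨h₀, h₁, cont, ctl_eq, hist_eq, pid_ne⟩
  obtain ⟨e, he, hstep⟩ := c.step_modify (I := I) M hp (.methOp (I.act q w') cont) w₁
  rw [hstep, List.append_assoc, List.cons_append]
  refine .intro h₀ _ cont ((c.step_ctl_of_ne M w₁ hp.symm).trans ctl_eq) (by simp [he, hist_eq]) ?_
  simpa [or_imp, forall_and, hp] using pid_ne

theorem of_step_ctl {op : Op R W (Q ⊕ Outcome)} {cont : Outcome → S}
    (h : (c.step I M p w).ctl p = .methOp op cont) :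
    ∃ q, ∀ w', FlipVariant I p q w w' (c.step I M p w) (c.step I M p w') := by
  obtain ⟨q, hstep, rfl⟩ := Config.step_eq_modify_of_methOp h
  refine ⟨q, fun w' => ?_⟩
  rw [hstep w']
  exact .intro c.hist [] cont h (congrArg Config.hist (hstep w)) (by simp)

theorem adversary_eq {ω ω' : ℕ → Ω} {t t' : ℕ}
    (h : FlipVariant I p q w w' (advRun I M A ω t) (advRun I M A ω' t')) (hA : RWOblivious I M A)
    (hreg : I.Accesses reg) : A (advRun I M A ω' t').hist = A (advRun I M A ω t).hist := by
  obtain ⟨σ, hσ⟩ := exists_run_eq_advRun (I := I) (M := M) (A := A) ω t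
  obtain ⟨σ', hσ'⟩ := exists_run_eq_advRun (I := I) (M := M) (A := A) ω' t'
  rw [← hσ, ← hσ'] at h ⊢
  exact hA _ _ _ _ h.map_pid_eq h.visibleFlips_eq (h.pendingReg_eq hreg)

end FlipVariant

theorem Config.flipIndex_step {p' : Fin n} {op : Op R W (Q ⊕ Outcome)} {cont : Outcome → S}
    (h : (c.step I M p' w).ctl p = .methOp op cont) :
    p' = p ∧ flipIndex p (c.step I M p' w).hist = c.flips ∨
      p' ≠ p ∧ c.ctl p = .methOp op cont ∧
        flipIndex p (c.step I M p' w).hist = flipIndex p c.hist := by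
  obtain ⟨e, he⟩ := c.exists_step_hist (I := I) M p' w
  rw [he]
  by_cases hp : p' = p
  · subst hp
    exact Or.inl ⟨rfl, flipIndex_append_cons (by simp) _ e⟩
  · exact Or.inr ⟨hp, c.step_ctl_of_ne M w (Ne.symm hp) ▸ h, flipIndex_concat_of_ne hp _ e⟩

/-- Resampling the coin flip that precedes a pending access of `p` in `elect()` goes unnoticed by
an r/w-oblivious adversary until `p` makes this access. -/
theorem flipVariant_advRun_update (hA : RWOblivious I M A) (hreg : I.Accesses reg) {ω : ℕ → Ω}
    {t : ℕ} {op : Op R W (Q ⊕ Outcome)} {cont : Outcome → S}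
    (h : (advRun I M A ω t).ctl p = .methOp op cont) :
    ∃ q, ∀ w, FlipVariant I p q (ω (flipIndex p (advRun I M A ω t).hist)) w (advRun I M A ω t)
      (advRun I M A (Function.update ω (flipIndex p (advRun I M A ω t).hist) w) t) := by
  induction t with
  | zero => simp [advRun, Config.initial] at h
  | succ t ih =>
    set c := advRun I M A ω t with hc
    rw [advRun, ← hc] at h ⊢
    rcases Config.flipIndex_step h with ⟨rfl, hindex⟩ | ⟨hp, hctl, hindex⟩ <;> rw [hindex]
    · obtain ⟨q, hq⟩ := FlipVariant.of_step_ctl h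
      refine ⟨q, fun w => ?_⟩
      have hcongr : c = advRun I M A (Function.update ω c.flips w) t :=
        advRun_congr fun i hi => (Function.update_of_ne hi.ne _ _).symm
      rw [advRun, ← hcongr, Function.update_self]
      exact hq w
    · obtain ⟨q, hq⟩ := ih hctl
      refine ⟨q, fun w => ?_⟩
      rw [advRun, (hq w).adversary_eq hA hreg, (hq w).flips_eq,
        Function.update_of_ne (hq w).flipIndex_lt_flips.ne']
      exact (hq w).step hp _

theorem flips_le_flipIndex {ω : ℕ → Ω} {s t : ℕ} (hst : s ≤ t)
    (hs : ((advRun I M A ω s).view reg).reg p = none) {op : Op R W (Q ⊕ Outcome)}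
    {cont : Outcome → S} (ht : (advRun I M A ω t).ctl p = .methOp op cont) :
    (advRun I M A ω s).flips ≤ flipIndex p (advRun I M A ω t).hist := by
  induction t, hst using Nat.le_induction with
  | base => simp [Config.view_reg_of_methOp ht] at hs
  | succ t hst ih =>
    rw [advRun] at ht ⊢
    rcases Config.flipIndex_step ht with ⟨-, hindex⟩ | ⟨-, hctl, hindex⟩ <;> rw [hindex]
    exacts [flips_advRun_mono ω hst, ih hctl]

open Classical in
/-- The index of the coin flip that precedes the next step, if that step is a shared memory step of
`elect()`. -/
noncomputable def pendingFlip (A : Adversary n Ω L V R W) (c : Config n Ω L V S Q R W) :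
    Option ℕ :=
  if ∃ op cont, c.ctl (A c.hist) = .methOp op cont then some (flipIndex (A c.hist) c.hist) else none

theorem exists_ctl_of_pendingFlip_eq_some {m : ℕ} (h : pendingFlip A c = some m) :
    (∃ op cont, c.ctl (A c.hist) = .methOp op cont) ∧ flipIndex (A c.hist) c.hist = m := by
  unfold pendingFlip at h
  split_ifs at h with hctl
  exact ⟨hctl, Option.some.inj h⟩

theorem view_advRun_update_of_pendingFlip (hA : RWOblivious I M A) (hreg : I.Accesses reg)
    {ω : ℕ → Ω} {t m : ℕ} (h : pendingFlip A (advRun I M A ω t) = some m) :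
    ∃ p q, ((advRun I M A ω t).view reg).reg p = some (reg q) ∧ ∀ w,
      pendingFlip A (advRun I M A (Function.update ω m w) t) = some m ∧
      (advRun I M A (Function.update ω m w) (t + 1)).view reg =
        ((advRun I M A ω t).view reg).access reg p (I.act q w) := by
  obtain ⟨⟨op, cont, hctl⟩, rfl⟩ := exists_ctl_of_pendingFlip_eq_some h
  obtain ⟨q, hq⟩ := flipVariant_advRun_update hA hreg hctl
  refine ⟨_, q, (hq (ω 0)).view_reg_eq hreg, fun w => ⟨?_, ?_⟩⟩
  · rw [pendingFlip, (hq w).adversary_eq hA hreg, if_pos (hq w).exists_ctl_eq,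
      (hq w).flipIndex_eq]
  · rw [advRun, (hq w).adversary_eq hA hreg, (hq w).view_step hreg]

theorem advRun_update_of_pendingFlip {ω : ℕ → Ω} {s t m : ℕ} (hst : s ≤ t)
    (hs : ∀ p, ((advRun I M A ω s).view reg).reg p = none)
    (h : pendingFlip A (advRun I M A ω t) = some m) (w : Ω) :
    advRun I M A (Function.update ω m w) s = advRun I M A ω s := by
  obtain ⟨⟨op, cont, hctl⟩, rfl⟩ := exists_ctl_of_pendingFlip_eq_some h
  exact (advRun_congr fun i hi => (Function.update_of_ne
    (hi.trans_le (flips_le_flipIndex hst (hs _) hctl)).ne _ _).symm).symm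

end HiddenFlip

section Resampling

variable {ι Ω : Type*} [MeasurableSpace Ω]

theorem measurable_of_dependsOn_finset [Countable Ω] [DiscreteMeasurableSpace Ω] {β : Type*}
    [MeasurableSpace β] {f : (ι → Ω) → β} {s : Finset ι} (hf : DependsOn f s) : Measurable f := by
  rcases isEmpty_or_nonempty β with hβ | hβ
  · have := Function.isEmpty f
    exact measurable_of_empty f
  · obtain ⟨g, rfl⟩ := dependsOn_iff_exists_comp.1 hf
    exact (Measurable.of_discrete (f := g)).comp
      (measurable_pi_lambda _ fun i => measurable_pi_apply _)

variable [DecidableEq ι] (D : Measure Ω) [IsProbabilityMeasure D]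

theorem map_update_infinitePi (m : ι) :
    ((Measure.infinitePi fun _ : ι => D).prod D).map
      (fun x : (ι → Ω) × Ω => Function.update x.1 m x.2) = Measure.infinitePi fun _ : ι => D := by
  refine Measure.eq_infinitePi _ fun s u hu => ?_
  rw [Measure.map_apply measurable_update' (MeasurableSet.pi s.countable_toSet fun i _ => hu i)]
  have hpre : (fun x : (ι → Ω) × Ω => Function.update x.1 m x.2) ⁻¹' (Set.pi s u) =
      (Set.pi (s.erase m : Finset ι) u) ×ˢ (if m ∈ s then u m else Set.univ) := by
    ext ⟨ω, w⟩
    simp only [Set.mem_preimage, Set.mem_pi, Finset.mem_coe, Set.mem_prod, Finset.mem_erase]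
    by_cases hm : m ∈ s
    · grind
    · grind
  rw [hpre, Measure.prod_prod, Measure.infinitePi_pi _ fun i _ => hu i]
  split_ifs with hm
  · exact Finset.prod_erase_mul s (fun i => D (u i)) hm
  · rw [measure_univ, mul_one, Finset.erase_eq_of_notMem hm]

theorem lintegral_update_infinitePi (m : ι) {f : (ι → Ω) → ℝ≥0∞} (hf : Measurable f) :
    ∫⁻ ω, ∫⁻ w, f (Function.update ω m w) ∂D ∂(Measure.infinitePi fun _ : ι => D) =
      ∫⁻ ω, f ω ∂(Measure.infinitePi fun _ : ι => D) := by
  conv_rhs => rw [← map_update_infinitePi D m]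
  rw [lintegral_map hf measurable_update', lintegral_prod]
  exact (hf.comp measurable_update').aemeasurable

theorem setLIntegral_update_infinitePi {m : ι} {f : (ι → Ω) → ℝ≥0∞} (hf : Measurable f)
    {G : Set (ι → Ω)} (hG : MeasurableSet G)
    (hupdate : ∀ ω ∈ G, ∀ w, Function.update ω m w ∈ G) :
    ∫⁻ ω in G, ∫⁻ w, f (Function.update ω m w) ∂D ∂(Measure.infinitePi fun _ : ι => D) =
      ∫⁻ ω in G, f ω ∂(Measure.infinitePi fun _ : ι => D) := by
  have hiff : ∀ ω w, Function.update ω m w ∈ G ↔ ω ∈ G := fun ω w =>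
    ⟨fun h => by simpa using hupdate _ h (ω m), fun h => hupdate ω h w⟩
  rw [← lintegral_indicator hG, ← lintegral_indicator hG,
    ← lintegral_update_infinitePi D m (hf.indicator hG)]
  refine lintegral_congr fun ω => ?_
  by_cases hω : ω ∈ G <;> simp [Set.indicator, hiff, hω]

/-- Comparison of expectations by averaging over a single coin, where the choice of that coin does
not depend on its value. -/
theorem setLIntegral_le_of_update [Countable ι] {Y Z : (ι → Ω) → ℝ≥0∞} (hY : Measurable Y)
    {B : Set (ι → Ω)} (hB : MeasurableSet B) {index : (ι → Ω) → Option ι}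
    (hindex : ∀ o, MeasurableSet {ω | index ω = o})
    (hnone : ∀ ω ∈ B, index ω = none → Y ω ≤ Z ω)
    (hupdate : ∀ ω ∈ B, ∀ m, index ω = some m →
      ∀ w, Function.update ω m w ∈ B ∧ index (Function.update ω m w) = some m)
    (hsome : ∀ ω ∈ B, ∀ m, index ω = some m → ∫⁻ w, Y (Function.update ω m w) ∂D ≤ Z ω) :
    ∫⁻ ω in B, Y ω ∂(Measure.infinitePi fun _ : ι => D) ≤
      ∫⁻ ω in B, Z ω ∂(Measure.infinitePi fun _ : ι => D) := by
  have hmeas : ∀ o, MeasurableSet (B ∩ {ω | index ω = o}) := fun o => hB.inter (hindex o)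
  have hunion : B = ⋃ o, B ∩ {ω | index ω = o} := by ext; simp
  have hdisjoint : Pairwise (Function.onFun Disjoint fun o => B ∩ {ω | index ω = o}) :=
    fun o o' hne => Set.disjoint_left.2 fun ω h h' => hne (h.2.symm.trans h'.2)
  rw [hunion, lintegral_iUnion hmeas hdisjoint, lintegral_iUnion hmeas hdisjoint]
  refine ENNReal.tsum_le_tsum fun o => ?_
  rcases o with _ | m
  · exact setLIntegral_mono' (hmeas none) fun ω hω => hnone ω hω.1 hω.2
  · rw [← setLIntegral_update_infinitePi D hY (hmeas (some m))
      fun ω hω w => hupdate ω hω.1 m hω.2 w]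
    exact setLIntegral_mono' (hmeas (some m)) fun ω hω => hsome ω hω.1 m hω.2

end Resampling

/-- Charges (expected future gains) for the analysis of `elect()`: `pending x` for a process that
accesses register `x` next, `win` for each call that returned `win`, and `mem g` for the register
contents `g`. -/
structure Potential (R W : Type*) where
  pending : R → ℝ≥0∞
  win : ℝ≥0∞
  mem : (R → W) → ℝ≥0∞

namespace Potential

variable {n : ℕ} {Ω L V S Q R W : Type*} {I : Impl Ω Q R W} {M : Algo n Ω L V S}
  {A : Adversary n Ω L V R W} {reg : Q → R} (Φ : Potential R W) {v : View n R W} {p : Fin n}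
  {k : ℕ}

/-- The charge for a returned value. -/
def outcome : Outcome → ℝ≥0∞
  | .win => Φ.win
  | .lose => 0

/-- The charge for a process after a shared memory step that leads to a local state or return
value. -/
def next (reg : Q → R) : Q ⊕ Outcome → ℝ≥0∞ :=
  Sum.elim (Φ.pending ∘ reg) Φ.outcome

/-- The charge for process `p`. -/
def process (v : View n R W) (p : Fin n) : ℝ≥0∞ :=
  (v.reg p).elim 0 Φ.pending + (v.result p).elim 0 Φ.outcome

/-- The total charge, including in advance the charge of those among at most `k` callers that have
not yet invoked `elect()`; `x₀` is the register accessed first. -/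
noncomputable def eval (x₀ : R) (k : ℕ) (v : View n R W) : ℝ≥0∞ :=
  (k - ∑ p, v.calls p : ℕ) * Φ.pending x₀ + ∑ p, Φ.process v p + Φ.mem v.gmem

/-- The charge does not increase on average over the coin flip that determines a shared memory
step. -/
def IsSuper [MeasurableSpace Ω] (D : Measure Ω) (I : Impl Ω Q R W) (reg : Q → R) : Prop :=
  ∀ q g, ∫⁻ w, (Φ.next reg ((I.act q w).apply g).1 + Φ.mem ((I.act q w).apply g).2) ∂D ≤
    Φ.pending (reg q) + Φ.mem g

theorem process_access_self_le (op : Op R W (Q ⊕ Outcome)) :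
    Φ.process (v.access reg p op) p ≤
      Φ.next reg (op.apply v.gmem).1 + (v.result p).elim 0 Φ.outcome := by
  rcases hop : (op.apply v.gmem).1 with q | o <;> simp [process, View.access, next, hop]

theorem process_of_ne {v v' : View n R W} (hreg : v'.reg p = v.reg p)
    (hresult : v'.result p = v.result p) : Φ.process v' p = Φ.process v p := by
  rw [process, process, hreg, hresult]

theorem exists_eval_eq_add {x x₀ : R} (hx : v.reg p = some x) :
    ∃ a, Φ.eval x₀ k v = a + (Φ.pending x + Φ.mem v.gmem) ∧
      ∀ op : Op R W (Q ⊕ Outcome), Φ.eval x₀ k (v.access reg p op) ≤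
        a + (Φ.next reg (op.apply v.gmem).1 + Φ.mem (op.apply v.gmem).2) := by
  refine ⟨(k - ∑ p, v.calls p : ℕ) * Φ.pending x₀ +
    (∑ p' ∈ Finset.univ.erase p, Φ.process v p' + (v.result p).elim 0 Φ.outcome), ?_, fun op => ?_⟩
  · rw [eval, ← Finset.sum_erase_add _ (Φ.process v) (Finset.mem_univ p),
      show Φ.process v p = Φ.pending x + (v.result p).elim 0 Φ.outcome by rw [process, hx]; rfl]
    ring
  · have hother : ∑ p' ∈ Finset.univ.erase p, Φ.process (v.access reg p op) p' =
        ∑ p' ∈ Finset.univ.erase p, Φ.process v p' :=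
      Finset.sum_congr rfl fun p' hp' => by
        have hne := Finset.ne_of_mem_erase hp'
        exact Φ.process_of_ne (by simp [View.access, hne]) (by simp [View.access, hne])
    rw [eval, ← Finset.sum_erase_add _ (Φ.process _) (Finset.mem_univ p), hother]
    calc _ ≤ (k - ∑ p, v.calls p : ℕ) * Φ.pending x₀ +
          (∑ p' ∈ Finset.univ.erase p, Φ.process v p' +
            (Φ.next reg (op.apply v.gmem).1 + (v.result p).elim 0 Φ.outcome)) +
          Φ.mem (op.apply v.gmem).2 := by
          gcongr
          · exact le_rfl
          · exact Φ.process_access_self_le op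
          · exact le_rfl
      _ = _ := by ring

theorem lintegral_eval_access_le [MeasurableSpace Ω] {D : Measure Ω} [IsProbabilityMeasure D]
    (hΦ : Φ.IsSuper D I reg) {q : Q} {x₀ : R} (hq : v.reg p = some (reg q)) :
    ∫⁻ w, Φ.eval x₀ k (v.access reg p (I.act q w)) ∂D ≤ Φ.eval x₀ k v := by
  obtain ⟨a, ha, hle⟩ := Φ.exists_eval_eq_add (reg := reg) (k := k) (x₀ := x₀) hq
  rw [ha]
  refine (lintegral_mono fun w => hle (I.act q w)).trans ?_
  rw [lintegral_add_left measurable_const, lintegral_const, measure_univ, mul_one]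
  gcongr
  exact hΦ q v.gmem

theorem eval_invoke {x₀ : R} (hp : v.reg p = none) (hk : ∑ p', (v.invoke p x₀).calls p' ≤ k) :
    Φ.eval x₀ k (v.invoke p x₀) = Φ.eval x₀ k v := by
  have hcalls : ∑ p', (v.invoke p x₀).calls p' = ∑ p', v.calls p' + 1 := by
    rw [← Finset.sum_erase_add _ v.calls (Finset.mem_univ p), View.invoke,
      Finset.sum_update_of_mem (Finset.mem_univ p), Finset.sdiff_singleton_eq_erase]
    ring
  have hprocess : ∑ p', Φ.process (v.invoke p x₀) p' = Φ.pending x₀ + ∑ p', Φ.process v p' := by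
    rw [← Finset.add_sum_erase _ _ (Finset.mem_univ p),
      ← Finset.add_sum_erase _ (Φ.process v) (Finset.mem_univ p), ← add_assoc]
    congr 1
    · simp [process, View.invoke, hp]
    · exact Finset.sum_congr rfl fun p' hp' =>
        Φ.process_of_ne (by simp [View.invoke, Finset.ne_of_mem_erase hp']) rfl
  obtain ⟨m, hm⟩ := Nat.exists_eq_add_of_le hk
  have hk' : k - ∑ p', v.calls p' = m + 1 := by omega
  rw [eval, eval, hprocess, hk', hm, Nat.add_sub_cancel_left]
  simp only [View.invoke]
  push_cast
  ring

end Potential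

section Expectation

variable {n k : ℕ} {Ω L V S Q R W : Type*} {I : Impl Ω Q R W} {M : Algo n Ω L V S}
  {A : Adversary n Ω L V R W} {reg : Q → R} {E : List (Record n Ω L V R W)}

theorem extensionEvent_eq (E : List (Record n Ω L V R W)) :
    extensionEvent I M A E = {ω | (advRun I M A ω E.length).hist = E} :=
  Set.ext fun _ => ⟨fun ⟨_, h⟩ => eq_hist_advRun_of_prefix h,
    fun h => ⟨E.length, Eq.symm h ▸ List.prefix_rfl⟩⟩

theorem view_eq_initial_of_mem_exec (hreg : I.Accesses reg) (hE : E ∈ Exec I M A k) {ω : ℕ → Ω}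
    (hω : (advRun I M A ω E.length).hist = E) :
    (advRun I M A ω E.length).view reg = View.initial n I := by
  obtain ⟨⟨ω₀, t, rfl, -, hpoised⟩, -⟩ := hE
  rw [length_hist_advRun] at hω ⊢
  rw [advRun_eq_of_hist_eq hω, view_advRun_of_not_poised hreg hpoised]

theorem sum_calls_le_of_mem_exec (hM : OneTime I M) (hE : E ∈ Exec I M A k) {ω : ℕ → Ω}
    (hω : (advRun I M A ω E.length).hist = E) {t : ℕ} (ht : E.length ≤ t) :
    ∑ p, (advRun I M A ω t).calls p ≤ k := by
  obtain ⟨σ, hσ⟩ := exists_run_eq_advRun (I := I) (M := M) (A := A) ω t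
  have hprefix := hist_advRun_prefix (I := I) (M := M) (A := A) ω ht
  rw [hω] at hprefix
  rw [← hσ] at hprefix ⊢
  have hcard : Set.encard {p | 1 ≤ (run I M σ ω).calls p} ≤ k :=
    iSup_le_iff.1 (iSup_le_iff.1 (iSup_le_iff.1 hE.2 σ) ω) hprefix
  rw [← Finset.coe_filter_univ, Set.encard_coe_eq_coe_finsetCard, Nat.cast_le,
    Finset.card_filter] at hcard
  refine le_trans (Finset.sum_le_sum fun p _ => ?_) hcard
  have := hM σ ω p
  split_ifs <;> omega

open Classical in
theorem OneTime.monotone_result_advRun (hM : OneTime I M) (hreg : I.Accesses reg) (p : Fin n)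
    (ω : ℕ → Ω) :
    Monotone fun t => if (advRun I M A ω t).result p = some .win then (1 : ℝ≥0∞) else 0 := by
  intro s t hst
  dsimp only
  split_ifs with hs ht ht
  · exact le_rfl
  · exact absurd (hM.view_advRun_mono hreg (P := fun v => v.result p = some .win)
      (fun v v' h => h.result_mono) ω hst hs) ht
  · exact zero_le
  · exact le_rfl

open Classical in
theorem OneTime.winners_le_iSup (hM : OneTime I M) (hreg : I.Accesses reg) (ω : ℕ → Ω) :
    winners I M A ω ≤
      ⨆ t, ∑ p, if (advRun I M A ω t).result p = some .win then (1 : ℝ≥0∞) else 0 := by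
  rw [← ENNReal.finsetSum_iSup_of_monotone (hM.monotone_result_advRun hreg · ω), winners,
    ← Finset.coe_filter_univ, Set.ncard_coe_finset, Finset.card_filter, Nat.cast_sum]
  refine Finset.sum_le_sum fun p _ => ?_
  split_ifs with h
  · obtain ⟨t, ht⟩ := h
    exact le_iSup_of_le t (by simp [ht])
  · simp

variable [Countable Ω] [MeasurableSpace Ω] [DiscreteMeasurableSpace Ω]

theorem measurable_comp_advRun {β : Type*} [MeasurableSpace β] (t : ℕ)
    (g : Config n Ω L V S Q R W → β) : Measurable fun ω => g (advRun I M A ω t) := by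
  refine measurable_of_dependsOn_finset (s := Finset.range t) fun ω ω' h => ?_
  rw [advRun_congr fun i hi => h i (by simpa using hi.trans_le (flips_advRun_le ω t))]

theorem measurableSet_advRun (t : ℕ) (P : Config n Ω L V S Q R W → Prop) :
    MeasurableSet {ω | P (advRun I M A ω t)} :=
  measurableSet_setOfPred.2 (measurable_comp_advRun t P)

namespace Potential

variable {Φ : Potential R W} {D : Measure Ω} [IsProbabilityMeasure D]

theorem setLIntegral_eval_succ_le (hΦ : Φ.IsSuper D I reg) (hA : RWOblivious I M A)
    (hreg : I.Accesses reg) {P : Config n Ω L V S Q R W → Prop} {s t : ℕ} (hst : s ≤ t)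
    (hidle : ∀ ω, P (advRun I M A ω s) → ∀ p, ((advRun I M A ω s).view reg).reg p = none)
    (hk : ∀ ω, P (advRun I M A ω s) → ∑ p, (advRun I M A ω (t + 1)).calls p ≤ k) :
    ∫⁻ ω in {ω | P (advRun I M A ω s)}, Φ.eval (reg I.start) k ((advRun I M A ω (t + 1)).view reg)
        ∂(Measure.infinitePi fun _ : ℕ => D) ≤
      ∫⁻ ω in {ω | P (advRun I M A ω s)}, Φ.eval (reg I.start) k ((advRun I M A ω t).view reg)
        ∂(Measure.infinitePi fun _ : ℕ => D) := by
  refine setLIntegral_le_of_update (index := fun ω => pendingFlip A (advRun I M A ω t)) D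
    (measurable_comp_advRun (t + 1) fun c => Φ.eval (reg I.start) k (c.view reg))
    (measurableSet_advRun s P) (fun o => measurableSet_advRun t fun c => pendingFlip A c = o)
    (fun ω hω hnone => ?_) (fun ω hω m hm w => ?_) (fun ω _ m hm => ?_)
  · have hcalls : ∑ p, ((advRun I M A ω (t + 1)).view reg).calls p ≤ k := hk ω hω
    rw [advRun] at hcalls ⊢
    rcases (advRun I M A ω t).view_step hreg M (A (advRun I M A ω t).hist)
      (ω (advRun I M A ω t).flips) with h | ⟨hpoised, h⟩ | ⟨op, cont, hctl, -⟩
    · rw [h]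
    · rw [h] at hcalls ⊢
      exact (Φ.eval_invoke hpoised.view_reg hcalls).le
    · simp [pendingFlip, hctl] at hnone
  · obtain ⟨p, q, -, hupdate⟩ := view_advRun_update_of_pendingFlip hA hreg hm
    refine ⟨?_, (hupdate w).1⟩
    rw [Set.mem_ofPred_eq, advRun_update_of_pendingFlip hst (hidle ω hω) hm]
    exact hω
  · obtain ⟨p, q, hq, hupdate⟩ := view_advRun_update_of_pendingFlip hA hreg hm
    simp only [fun w => (hupdate w).2]
    exact Φ.lintegral_eval_access_le hΦ hq

theorem lintegral_cond_eval_le (hΦ : Φ.IsSuper D I reg) (hM : OneTime I M)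
    (hA : RWOblivious I M A) (hreg : I.Accesses reg) (hE : E ∈ Exec I M A k) {t : ℕ}
    (ht : E.length ≤ t) :
    ∫⁻ ω, Φ.eval (reg I.start) k ((advRun I M A ω t).view reg)
        ∂(cond (Measure.infinitePi fun _ : ℕ => D) (extensionEvent I M A E)) ≤
      k * Φ.pending (reg I.start) + Φ.mem I.init := by
  set μ := Measure.infinitePi fun _ : ℕ => D
  set B := {ω | (advRun I M A ω E.length).hist = E} with hB
  set b := k * Φ.pending (reg I.start) + Φ.mem I.init
  have hview : ∀ ω ∈ B, (advRun I M A ω E.length).view reg = View.initial n I := fun ω hω =>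
    view_eq_initial_of_mem_exec hreg hE hω
  have hbound : ∫⁻ ω in B, Φ.eval (reg I.start) k ((advRun I M A ω t).view reg) ∂μ ≤ b * μ B := by
    induction t, ht using Nat.le_induction with
    | base =>
      rw [← setLIntegral_const]
      refine setLIntegral_mono' (measurableSet_advRun _ fun c => c.hist = E) fun ω hω => ?_
      simp [hview ω hω, eval, process, View.initial, b]
    | succ t hst ih =>
      refine le_trans (setLIntegral_eval_succ_le hΦ hA hreg (P := fun c => c.hist = E) hst ?_ ?_) ih
      · exact fun ω hω p => by rw [hview ω hω]; rfl
      · exact fun ω hω => sum_calls_le_of_mem_exec hM hE hω (by omega)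
  rw [extensionEvent_eq, ← hB, ProbabilityTheory.cond, lintegral_smul_measure, smul_eq_mul]
  calc (μ B)⁻¹ * _ ≤ (μ B)⁻¹ * (b * μ B) := by gcongr
    _ = b * ((μ B)⁻¹ * μ B) := by ring
    _ ≤ b := mul_le_of_le_one_right' (ENNReal.inv_mul_le_one _)

theorem lintegral_winners_le (hΦ : Φ.IsSuper D I reg) (hwin : 1 ≤ Φ.win) (hM : OneTime I M)
    (hA : RWOblivious I M A) (hreg : I.Accesses reg) (hE : E ∈ Exec I M A k) :
    ∫⁻ ω, winners I M A ω
        ∂(cond (Measure.infinitePi fun _ : ℕ => D) (extensionEvent I M A E)) ≤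
      k * Φ.pending (reg I.start) + Φ.mem I.init := by
  classical
  let wins (t : ℕ) (ω : ℕ → Ω) : ℝ≥0∞ :=
    ∑ p, if (advRun I M A ω t).result p = some .win then 1 else 0
  have hmono : Monotone wins := fun s t hst ω =>
    Finset.sum_le_sum fun p _ => hM.monotone_result_advRun hreg p ω hst
  have hwins : ∀ t ω, wins t ω ≤ Φ.eval (reg I.start) k ((advRun I M A ω t).view reg) := by
    intro t ω
    refine le_add_right (le_add_left (Finset.sum_le_sum fun p _ => ?_))
    split_ifs with h
    · refine le_add_left ?_
      rw [show ((advRun I M A ω t).view reg).result p = some .win from h]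
      exact hwin
    · exact zero_le
  refine (lintegral_mono (hM.winners_le_iSup hreg)).trans ?_
  rw [lintegral_iSup (fun t => measurable_comp_advRun t fun c => ∑ p,
    if c.result p = some .win then (1 : ℝ≥0∞) else 0) hmono]
  refine iSup_le fun t => (lintegral_mono (hmono (le_max_left t E.length))).trans ?_
  exact (lintegral_mono (hwins _)).trans
    (lintegral_cond_eval_le hΦ hM hA hreg hE (le_max_right t E.length))

theorem lintegral_mem_le (hΦ : Φ.IsSuper D I reg) (hM : OneTime I M) (hA : RWOblivious I M A)
    (hreg : I.Accesses reg) (hE : E ∈ Exec I M A k) {t : ℕ} (ht : E.length ≤ t) :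
    ∫⁻ ω, Φ.mem (advRun I M A ω t).gmem
        ∂(cond (Measure.infinitePi fun _ : ℕ => D) (extensionEvent I M A E)) ≤
      k * Φ.pending (reg I.start) + Φ.mem I.init :=
  (lintegral_mono fun _ => le_add_self).trans (lintegral_cond_eval_le hΦ hM hA hreg hE ht)

end Potential

end Expectation

section Sift

variable {n ℓ : ℕ} {Ω L V S : Type*} {H : ℕ → Set Ω}

/-- The register accessed in the round of the sifting algorithm that starts in a given local
state. -/
def SiftState.reg : SiftState → SiftReg
  | .backward i => .up i
  | .forward i => .down i

/-- The round in which the register is accessed. -/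
def SiftReg.index : SiftReg → ℕ
  | .up i => i
  | .down i => i

/-- The position of a register in the order in which each process accesses the registers. -/
def SiftReg.pos : SiftReg → ℕ ⊕ₗ ℕᵒᵈ
  | .up i => Sum.inlₗ i
  | .down i => Sum.inrₗ (OrderDual.toDual i)

/-- The continuation of the sifting algorithm after choosing heads. -/
def SiftState.onHeads (ℓ : ℕ) : SiftState → SiftState ⊕ Outcome
  | .backward i => if i = ℓ then siftLoop i else .inl (.backward (i + 1))
  | .forward i => siftLoop i

theorem sift_act (q : SiftState) (w : Ω) [Decidable (w ∈ H q.reg.index)] :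
    (sift ℓ H).act q w =
      if w ∈ H q.reg.index then .write q.reg true (q.onHeads ℓ)
      else .read q.reg fun v => if v = true then .inr .lose else siftLoop q.reg.index := by
  rcases q with i | i <;> by_cases hw : w ∈ H i <;>
    simp [sift, hw, SiftState.reg, SiftReg.index, SiftState.onHeads]

theorem sift_accesses : (sift ℓ H).Accesses SiftState.reg := by
  classical
  intro q w
  rw [sift_act]
  split_ifs <;> rfl

theorem sift_act_apply [DecidableEq SiftReg] (q : SiftState) (w : Ω) (g : SiftReg → Bool)
    [Decidable (w ∈ H q.reg.index)] :
    ((sift ℓ H).act q w).apply g =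
      if w ∈ H q.reg.index then (q.onHeads ℓ, Function.update g q.reg true)
      else (if g q.reg = true then .inr .lose else siftLoop q.reg.index, g) := by
  rw [sift_act]
  by_cases hw : w ∈ H q.reg.index
  · simp only [if_pos hw, Op.apply]
    congr!
  · simp only [if_neg hw, Op.apply]

theorem eq_or_of_sift_apply {q : SiftState} {w : Ω} {g : SiftReg → Bool} {y : SiftReg}
    (hy : (((sift ℓ H).act q w).apply g).2 y = true) : y = q.reg ∨ g y = true := by
  classical
  rw [sift_act_apply] at hy
  by_cases hw : w ∈ H q.reg.index <;> simp only [hw, if_true, if_false] at hy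
  · by_cases hyq : y = q.reg
    · exact Or.inl hyq
    · exact Or.inr (by simpa [hyq] using hy)
  · exact Or.inr hy

theorem sift_apply_mono (q : SiftState) (w : Ω) {g : SiftReg → Bool} {y : SiftReg}
    (hy : g y = true) : (((sift ℓ H).act q w).apply g).2 y = true := by
  classical
  rw [sift_act_apply]
  by_cases hw : w ∈ H q.reg.index <;> simp only [hw, if_true, if_false]
  · by_cases hyq : y = q.reg <;> simp [hyq, hy]
  · exact hy

/-- The possible results of the round of the sifting algorithm that starts in local state `q`: the
process returns, or continues with the next round of the forward phase, or of the backward phase. -/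
inductive SiftRound (ℓ : ℕ) (q : SiftState) (g : SiftReg → Bool) :
    (SiftState ⊕ Outcome) × (SiftReg → Bool) → Prop
  | returned {o : Outcome} {g' : SiftReg → Bool} (outcome_eq : g q.reg = false → o = .win) :
      SiftRound ℓ q g (.inr o, g')
  | forward {g' : SiftReg → Bool} (one_lt : 1 < q.reg.index) :
      SiftRound ℓ q g (.inl (.forward (q.reg.index - 1)), g')
  | backward {i : ℕ} {g' : SiftReg → Bool} (state_eq : q = .backward i) (ne : i ≠ ℓ)
      (written : g' (.up i) = true) : SiftRound ℓ q g (.inl (.backward (i + 1)), g')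

theorem SiftRound.siftLoop (q : SiftState) (g g' : SiftReg → Bool) :
    SiftRound ℓ q g (siftLoop q.reg.index, g') := by
  unfold GroupElect.siftLoop
  split_ifs with h
  exacts [.forward h, .returned fun _ => rfl]

theorem siftRound_act_apply (q : SiftState) (w : Ω) (g : SiftReg → Bool) :
    SiftRound ℓ q g (((sift ℓ H).act q w).apply g) := by
  classical
  rw [sift_act_apply]
  split_ifs with hw hg
  · rcases q with i | i
    · simp only [SiftState.onHeads]
      split_ifs with hi
      · exact .siftLoop (.backward i) g _
      · exact .backward rfl hi (Function.update_self ..)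
    · exact .siftLoop (.forward i) g _
  · exact .returned fun hg' => by simp [hg] at hg'
  · exact .siftLoop q g g

theorem SiftRound.pos_lt {q q' : SiftState} {g : SiftReg → Bool}
    {x : (SiftState ⊕ Outcome) × (SiftReg → Bool)} (h : SiftRound ℓ q g x) (hx : x.1 = .inl q') :
    q.reg.pos < q'.reg.pos := by
  rcases h with _ | hi | ⟨rfl, -, -⟩ <;> simp only [reduceCtorEq, Sum.inl.injEq] at hx
  · subst hx
    rcases q with i | i
    · exact Sum.Lex.inl_lt_inr _ _
    · simp only [SiftState.reg, SiftReg.index, SiftReg.pos, Sum.Lex.inr_lt_inr_iff,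
        OrderDual.toDual_lt_toDual] at hi ⊢
      omega
  · subst hx
    simp [SiftState.reg, SiftReg.pos]

theorem SiftRound.outcome_eq {q : SiftState} {o : Outcome} {g : SiftReg → Bool}
    {x : (SiftState ⊕ Outcome) × (SiftReg → Bool)} (h : SiftRound ℓ q g x) (hx : x.1 = .inr o)
    (hg : g q.reg = false) : o = .win := by
  rcases h with outcome_eq | _ | _ <;> simp only [reduceCtorEq, Sum.inr.injEq] at hx
  exact hx ▸ outcome_eq hg

/-- Some process has not returned and is ahead of all writes made so far. It can only lose after
another process has overtaken it. -/
def View.HasLeader (v : View n SiftReg Bool) : Prop :=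
  ∃ p x, v.reg p = some x ∧ ∀ y, v.gmem y = true → y.pos < x.pos

theorem View.HasLeader.access {v : View n SiftReg Bool} (h : v.HasLeader) {p : Fin n}
    {q : SiftState} (hq : v.reg p = some q.reg) (w : Ω) :
    (∃ p', (v.access SiftState.reg p ((sift ℓ H).act q w)).result p' = some .win) ∨
      (v.access SiftState.reg p ((sift ℓ H).act q w)).HasLeader := by
  obtain ⟨p₀, x, hx, hwritten⟩ := h
  by_cases hlt : q.reg.pos < x.pos
  · have hne : p₀ ≠ p := by
      rintro rfl
      rw [hq, Option.some.injEq] at hx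
      exact (hx ▸ hlt).false
    refine Or.inr ⟨p₀, x, by simpa [View.access, hne], fun y hy => ?_⟩
    rcases eq_or_of_sift_apply hy with rfl | hy
    exacts [hlt, hwritten y hy]
  · have hunwritten : v.gmem q.reg = false := by
      simpa using mt (hwritten q.reg) hlt
    have hround := siftRound_act_apply (ℓ := ℓ) (H := H) q w v.gmem
    rcases hr : (((sift ℓ H).act q w).apply v.gmem).1 with q' | o
    · refine Or.inr ⟨p, q'.reg, by simp [View.access, hr], fun y hy => ?_⟩
      rcases eq_or_of_sift_apply hy with rfl | hy
      · exact hround.pos_lt hr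
      · exact ((hwritten y hy).trans_le (not_lt.1 hlt)).trans (hround.pos_lt hr)
    · refine Or.inl ⟨p, ?_⟩
      simp [View.access, hr, hround.outcome_eq hr hunwritten]

theorem OneTime.winner_or_hasLeader {M : Algo n Ω L V S} (hM : OneTime (sift ℓ H) M)
    (σ : List (Fin n)) (ω : ℕ → Ω) :
    let v := (run (sift ℓ H) M σ ω).view SiftState.reg
    (∃ p, v.result p = some .win) ∨ v = View.initial n (sift ℓ H) ∨ v.HasLeader := by
  refine hM.view_induction sift_accesses (P := fun v => (∃ p, v.result p = some .win) ∨
    v = View.initial n (sift ℓ H) ∨ v.HasLeader) (Or.inr (Or.inl rfl)) (fun v v' hnext h => ?_) σ ω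
  rcases h with ⟨p, hp⟩ | rfl | hleader
  · exact Or.inl ⟨p, hnext.result_mono hp⟩
  · rcases hnext with _ | ⟨p, -, -, -⟩ | ⟨p, q, w, hq, -⟩
    · exact Or.inr (Or.inl rfl)
    · exact Or.inr (Or.inr ⟨p, .up 1, by simp [View.invoke, sift, SiftState.reg],
        fun y hy => by simp [View.invoke, View.initial, sift] at hy⟩)
    · simp [View.initial] at hq
  · rcases hnext with _ | ⟨p, hp, -, -⟩ | ⟨p, q, w, hq, -⟩
    · exact Or.inr (Or.inr hleader)
    · obtain ⟨p₀, x, hx, hwritten⟩ := hleader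
      have hne : p₀ ≠ p := by rintro rfl; simp [hx] at hp
      exact Or.inr (Or.inr ⟨p₀, x, by simpa [View.invoke, hne], hwritten⟩)
    · exact (hleader.access hq w).imp_right Or.inr

theorem OneTime.notAllLose {M : Algo n Ω L V S} (hM : OneTime (sift ℓ H) M) :
    NotAllLose (sift ℓ H) M := by
  intro σ ω ⟨p, hp⟩ hreturned
  rcases hM.winner_or_hasLeader σ ω with hwin | hinitial | ⟨p', x, hx, -⟩
  · exact hwin
  · have hcalls : (run (sift ℓ H) M σ ω).calls p = 0 := congrArg (fun v => v.calls p) hinitial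
    omega
  · rcases hM.status sift_accesses σ ω p' with ⟨hx', -⟩ | ⟨_, -, hc, hr⟩ | ⟨_, hx', -⟩
    · simp [hx] at hx'
    · exact absurd hr (hreturned p' (Nat.le_of_eq (Eq.symm hc)))
    · simp [hx] at hx'

/-- The invariant behind the step bound: `p` has reached round `j` of its backward phase, so that
`Up[1..j-1]` are written, and has at most two accesses per round. -/
structure View.StepBound (v : View n SiftReg Bool) (ℓ : ℕ) (p : Fin n) (j : ℕ) : Prop where
  one_le : 1 ≤ j
  le : j ≤ ℓ
  written : ∀ r, 1 ≤ r → r < j → v.gmem (.up r) = true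
  index_pos : ∀ x, v.reg p = some x → 1 ≤ x.index
  up_eq : ∀ i, v.reg p = some (.up i) → i = j
  steps_le : v.steps p + (v.reg p).elim 0 SiftReg.index + 1 ≤ 2 * j

theorem View.StepBound.of_eq {v v' : View n SiftReg Bool} {p : Fin n} {j : ℕ}
    (h : v.StepBound ℓ p j) (hreg : v'.reg p = v.reg p) (hsteps : v'.steps p = v.steps p)
    (hmem : ∀ y, v.gmem y = true → v'.gmem y = true) : v'.StepBound ℓ p j where
  one_le := h.one_le
  le := h.le
  written r hr hrj := hmem _ (h.written r hr hrj)
  index_pos x hx := h.index_pos x (hreg ▸ hx)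
  up_eq i hi := h.up_eq i (hreg ▸ hi)
  steps_le := by rw [hreg, hsteps]; exact h.steps_le

theorem View.StepBound.round {v v' : View n SiftReg Bool} {p : Fin n} {j : ℕ}
    (h : v.StepBound ℓ p j) {q : SiftState} (hq : v.reg p = some q.reg)
    {x : (SiftState ⊕ Outcome) × (SiftReg → Bool)} (hround : SiftRound ℓ q v.gmem x)
    (hreg : v'.reg p = x.1.elim (some ∘ SiftState.reg) fun _ => none)
    (hsteps : v'.steps p = v.steps p + 1) (hgmem : v'.gmem = x.2)
    (hmono : ∀ y, v.gmem y = true → v'.gmem y = true) : ∃ j', v'.StepBound ℓ p j' := by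
  have hle : v.steps p + q.reg.index + 1 ≤ 2 * j := by simpa [hq] using h.steps_le
  have hpos := h.index_pos _ hq
  have hwritten : ∀ r, 1 ≤ r → r < j → v'.gmem (.up r) = true :=
    fun r hr hrj => hmono _ (h.written r hr hrj)
  rcases hround with _ | one_lt | @⟨i, _, rfl, ne, written⟩
  · replace hreg : v'.reg p = none := hreg
    refine ⟨j, h.one_le, h.le, hwritten, by simp [hreg], by simp [hreg], ?_⟩
    rw [hreg, hsteps, Option.elim_none]
    omega
  · replace hreg : v'.reg p = some (.down (q.reg.index - 1)) := hreg
    refine ⟨j, h.one_le, h.le, hwritten, ?_, by simp [hreg], ?_⟩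
    · simp only [hreg, Option.some.injEq, forall_eq']
      exact Nat.le_sub_of_add_le one_lt
    · rw [hreg, hsteps, Option.elim_some]
      change v.steps p + 1 + (q.reg.index - 1) + 1 ≤ 2 * j
      omega
  · replace hreg : v'.reg p = some (.up (i + 1)) := hreg
    obtain rfl : i = j := h.up_eq i hq
    refine ⟨i + 1, by omega, Nat.lt_of_le_of_ne h.le ne, fun r hr hri => ?_,
      by simp [hreg, SiftReg.index], by simp [hreg], ?_⟩
    · rcases Nat.lt_succ_iff_lt_or_eq.1 hri with hri | rfl
      exacts [hwritten r hr hri, hgmem ▸ written]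
    · rw [hreg, hsteps, Option.elim_some]
      change v.steps p + i + 1 ≤ 2 * i at hle
      change v.steps p + 1 + (i + 1) + 1 ≤ 2 * (i + 1)
      omega

theorem View.StepBound.access {v : View n SiftReg Bool} {p : Fin n} {j : ℕ}
    (h : v.StepBound ℓ p j) {q : SiftState} (hq : v.reg p = some q.reg) (w : Ω) :
    ∃ j', (v.access SiftState.reg p ((sift ℓ H).act q w)).StepBound ℓ p j' :=
  h.round hq (siftRound_act_apply q w v.gmem) (by simp [View.access]) (by simp [View.access]) rfl
    fun _ => sift_apply_mono q w

theorem View.Next.gmem_mono {v v' : View n SiftReg Bool}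
    (h : View.Next (sift ℓ H) SiftState.reg v v') {y : SiftReg} (hy : v.gmem y = true) :
    v'.gmem y = true := by
  rcases h with _ | _ | ⟨p, q, w, -, -⟩
  exacts [hy, hy, sift_apply_mono q w hy]

theorem View.Next.exists_stepBound (hℓ : 1 ≤ ℓ) {v v' : View n SiftReg Bool}
    (hnext : View.Next (sift ℓ H) SiftState.reg v v') {p : Fin n}
    (h : v.steps p = 0 ∧ v.reg p = none ∨ ∃ j, v.StepBound ℓ p j) :
    v'.steps p = 0 ∧ v'.reg p = none ∨ ∃ j, v'.StepBound ℓ p j := by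
  have hmem := fun y => hnext.gmem_mono (y := y)
  rcases hnext with _ | ⟨p', hp', -, hsteps⟩ | ⟨p', q, w, hq, -⟩
  · exact h
  · by_cases hp : p = p'
    · subst hp
      refine Or.inr ⟨1, le_rfl, hℓ, by omega, ?_, ?_, ?_⟩ <;>
        simp [View.invoke, hsteps, sift, SiftState.reg, SiftReg.index]
    · refine h.imp (fun h => ?_) fun ⟨j, h⟩ => ⟨j, h.of_eq ?_ rfl hmem⟩ <;>
        simp [View.invoke, hp, h]
  · by_cases hp : p = p'
    · subst hp
      rcases h with ⟨-, hnone⟩ | ⟨j, h⟩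
      · simp [hnone] at hq
      · exact Or.inr (h.access hq w)
    · refine h.imp (fun h => ?_) fun ⟨j, h⟩ => ⟨j, h.of_eq ?_ ?_ hmem⟩ <;>
        simp_all [View.access]

theorem OneTime.steps_le {M : Algo n Ω L V S} (hM : OneTime (sift ℓ H) M) (hℓ : 1 ≤ ℓ)
    (σ : List (Fin n)) (ω : ℕ → Ω) (p : Fin n) :
    let c := run (sift ℓ H) M σ ω
    c.steps p ≤ 1 + 2 * ((Finset.Ico 1 ℓ).filter fun r => c.gmem (.up r) = true).card := by
  intro c
  rcases hM.view_induction sift_accesses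
    (P := fun v => v.steps p = 0 ∧ v.reg p = none ∨ ∃ j, v.StepBound ℓ p j) (Or.inl ⟨rfl, rfl⟩)
    (fun v v' hnext h => hnext.exists_stepBound hℓ h) σ ω with ⟨h, -⟩ | ⟨j, h⟩
  · have : c.steps p = 0 := h
    omega
  · have hsub : Finset.Ico 1 j ⊆ (Finset.Ico 1 ℓ).filter fun r => c.gmem (.up r) = true :=
      fun r hr => by
        rw [Finset.mem_Ico] at hr
        exact Finset.mem_filter.2
          ⟨Finset.mem_Ico.2 ⟨hr.1, hr.2.trans_le h.le⟩, h.written r hr.1 hr.2⟩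
    have hcard := Finset.card_le_card hsub
    have hsteps : c.steps p + _ + 1 ≤ 2 * j := h.steps_le
    rw [Nat.card_Ico] at hcard
    omega

theorem OneTime.steps_advRun_le {M : Algo n Ω L V S}
    {A : Adversary n Ω L V SiftReg Bool} (hM : OneTime (sift ℓ H) M) (hℓ : 1 ≤ ℓ) (ω : ℕ → Ω)
    (p : Fin n) (t : ℕ) : ((advRun (sift ℓ H) M A ω t).steps p : ℝ≥0∞) ≤
      1 + 2 * ∑ r ∈ Finset.Ico 1 ℓ, if (advRun (sift ℓ H) M A ω t).gmem (.up r) then 1 else 0 := by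
  obtain ⟨σ, hσ⟩ := exists_run_eq_advRun (I := sift ℓ H) (M := M) (A := A) ω t
  rw [← hσ]
  refine (Nat.cast_le.2 (hM.steps_le hℓ σ ω p)).trans_eq ?_
  simp

theorem OneTime.monotone_written_advRun {M : Algo n Ω L V S}
    {A : Adversary n Ω L V SiftReg Bool} (hM : OneTime (sift ℓ H) M) (x : SiftReg)
    (ω : ℕ → Ω) :
    Monotone fun t => if (advRun (sift ℓ H) M A ω t).gmem x then (1 : ℝ≥0∞) else 0 := by
  intro s t hst
  dsimp only
  split_ifs with hs ht ht
  · exact le_rfl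
  · exact absurd (hM.view_advRun_mono sift_accesses (P := fun v => v.gmem x = true)
      (fun v v' h => h.gmem_mono) ω hst hs) ht
  · exact zero_le
  · exact le_rfl

end Sift

section SiftPotential

variable {n ℓ k : ℕ} {Ω L V S : Type*} {H : ℕ → Set Ω} [MeasurableSpace Ω]

/-- The probability of heads in all rounds `1, …, i` of one phase. -/
noncomputable def headsProd (D : Measure Ω) (H : ℕ → Set Ω) (i : ℕ) : ℝ≥0∞ :=
  ∏ j ∈ Finset.Ico 1 (i + 1), D (H j)

/-- The probability that a process which starts round `i` of the backward phase only writes until it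
returns. -/
noncomputable def upValue (D : Measure Ω) (H : ℕ → Set Ω) (ℓ i : ℕ) : ℝ≥0∞ :=
  (∏ j ∈ Finset.Ico i (ℓ + 1), D (H j)) * headsProd D H (ℓ - 1)

/-- The number of winners to charge to an unwritten register of round `i`: the expected number of
processes that read it before it is written is at most `1 / D (H i)`, and each of them wins with
probability `headsProd D H (i - 1)` by writing only. -/
noncomputable def regValue (D : Measure Ω) (H : ℕ → Set Ω) (i : ℕ) : ℝ≥0∞ :=
  headsProd D H (i - 1) / D (H i)

/-- The registers of rounds `1, …, ℓ`; the algorithm does not access `Down[ℓ]`, whose charge does no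
harm. -/
def siftRegs (ℓ : ℕ) : Finset SiftReg :=
  ((Finset.Icc 1 ℓ).map ⟨.up, fun _ _ => SiftReg.up.inj⟩).disjUnion
    ((Finset.Icc 1 ℓ).map ⟨.down, fun _ _ => SiftReg.down.inj⟩) (by
      rw [Finset.disjoint_left]
      rintro _ hup hdown
      obtain ⟨i, _, rfl⟩ := Finset.mem_map.1 hup
      obtain ⟨j, _, ⟨⟩⟩ := Finset.mem_map.1 hdown)

/-- The potential that bounds the number of winners: a process is charged for winning by writing
only, and an unwritten register for the processes that read it. The charge `⊤` of the registers of
other rounds, which are never reached, makes the potential a supermartingale there too. -/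
noncomputable def winPotential (D : Measure Ω) (H : ℕ → Set Ω) (ℓ : ℕ) :
    Potential SiftReg Bool where
  pending
    | .up i => if i ∈ Finset.Icc 1 ℓ then upValue D H ℓ i else ⊤
    | .down i => if i ∈ Finset.Icc 1 ℓ then headsProd D H i else ⊤
  win := 1
  mem g := ∑ x ∈ siftRegs ℓ, if g x then 0 else regValue D H x.index

/-- The potential that bounds the probability that `Up[r]` is written. -/
noncomputable def upPotential (D : Measure Ω) (H : ℕ → Set Ω) (r : ℕ) : Potential SiftReg Bool where
  pending
    | .up i => if i ≤ r then ∏ j ∈ Finset.Ico i (r + 1), D (H j) else 0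
    | .down _ => 0
  win := 0
  mem g := if g (.up r) then 1 else 0

variable (D : Measure Ω)

theorem mem_siftRegs {x : SiftReg} : x ∈ siftRegs ℓ ↔ x.index ∈ Finset.Icc 1 ℓ := by
  rw [siftRegs, Finset.mem_disjUnion, Finset.mem_map, Finset.mem_map]
  constructor
  · rintro (⟨i, hi, rfl⟩ | ⟨i, hi, rfl⟩) <;> exact hi
  · rcases x with i | i
    exacts [fun hi => .inl ⟨i, hi, rfl⟩, fun hi => .inr ⟨i, hi, rfl⟩]

theorem headsProd_zero : headsProd D H 0 = 1 := by simp [headsProd]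

theorem headsProd_pred_mul {i : ℕ} (hi : 1 ≤ i) :
    headsProd D H (i - 1) * D (H i) = headsProd D H i := by
  obtain ⟨i, rfl⟩ := Nat.exists_eq_add_of_le' hi
  rw [Nat.add_sub_cancel, headsProd, headsProd, Finset.prod_Ico_succ_top hi]

theorem upValue_succ_mul {i : ℕ} (hi : i ≤ ℓ) :
    upValue D H ℓ (i + 1) * D (H i) = upValue D H ℓ i := by
  rw [upValue, upValue, Finset.prod_eq_prod_Ico_succ_bot (a := i) (by omega)]
  ring

theorem winPotential_next_siftLoop {i : ℕ} (hi : i ∈ Finset.Icc 1 ℓ) :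
    (winPotential D H ℓ).next SiftState.reg (siftLoop i) = headsProd D H (i - 1) := by
  rw [Finset.mem_Icc] at hi
  unfold siftLoop
  split_ifs with h
  · exact if_pos (Finset.mem_Icc.2 (by omega))
  · rw [show i = 1 by omega, Nat.sub_self, headsProd_zero]
    rfl

theorem winPotential_next_onHeads {q : SiftState} (hq : q.reg.index ∈ Finset.Icc 1 ℓ) :
    (winPotential D H ℓ).next SiftState.reg (q.onHeads ℓ) * D (H q.reg.index) =
      (winPotential D H ℓ).pending q.reg := by
  rcases q with i | i <;> change i ∈ Finset.Icc 1 ℓ at hq <;> have hi := Finset.mem_Icc.1 hq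
  · have hnext : (winPotential D H ℓ).next SiftState.reg ((SiftState.backward i).onHeads ℓ) =
        upValue D H ℓ (i + 1) := by
      simp only [SiftState.onHeads]
      split_ifs with h
      · subst h
        rw [winPotential_next_siftLoop D hq]
        simp [upValue]
      · exact if_pos (Finset.mem_Icc.2 (by omega))
    rw [hnext]
    exact (upValue_succ_mul D hi.2).trans (if_pos hq).symm
  · rw [SiftState.onHeads, winPotential_next_siftLoop D hq]
    exact (headsProd_pred_mul D hi.1).trans (if_pos hq).symm

theorem winPotential_mem_eq_add [DecidableEq SiftReg] (g : SiftReg → Bool) {x : SiftReg}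
    (hx : x.index ∈ Finset.Icc 1 ℓ) :
    (winPotential D H ℓ).mem g = (winPotential D H ℓ).mem (Function.update g x true) +
      if g x then 0 else regValue D H x.index := by
  have hx' := mem_siftRegs.2 hx
  simp only [winPotential]
  rw [← Finset.sum_erase_add _ _ hx', ← Finset.sum_erase_add (siftRegs ℓ) (fun y =>
    if Function.update g x true y then 0 else regValue D H y.index) hx', Function.update_self,
    if_pos rfl, add_zero]
  congr 1
  exact Finset.sum_congr rfl fun y hy => by rw [Function.update_of_ne (Finset.ne_of_mem_erase hy)]

theorem upPotential_next_siftLoop (r i : ℕ) :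
    (upPotential D H r).next SiftState.reg (siftLoop i) = 0 := by
  unfold siftLoop
  split_ifs <;> rfl

theorem upPotential_next_onHeads {r : ℕ} (hr : r < ℓ) {q : SiftState} (hq : q.reg ≠ .up r) :
    (upPotential D H r).next SiftState.reg (q.onHeads ℓ) * D (H q.reg.index) =
      (upPotential D H r).pending q.reg := by
  rcases q with i | i
  · rcases lt_or_gt_of_ne (fun h => hq (congrArg SiftReg.up h) : i ≠ r) with hir | hri
    · have hnext : (upPotential D H r).next SiftState.reg ((SiftState.backward i).onHeads ℓ) =
          ∏ j ∈ Finset.Ico (i + 1) (r + 1), D (H j) := by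
        rw [SiftState.onHeads, if_neg (by omega)]
        exact if_pos (Nat.succ_le_of_lt hir)
      have hpending : (upPotential D H r).pending (.up i) = ∏ j ∈ Finset.Ico i (r + 1), D (H j) :=
        if_pos hir.le
      rw [hnext, SiftState.reg, hpending, Finset.prod_eq_prod_Ico_succ_bot (a := i) (by omega),
        mul_comm]
      rfl
    · have hnext : (upPotential D H r).next SiftState.reg ((SiftState.backward i).onHeads ℓ) =
          0 := by
        rw [SiftState.onHeads]
        split_ifs
        exacts [upPotential_next_siftLoop D r i, if_neg (by omega)]
      rw [hnext, zero_mul]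
      exact (if_neg (by omega)).symm
  · rw [SiftState.onHeads, upPotential_next_siftLoop, zero_mul]
    rfl

theorem upPotential_onHeads_le [DecidableEq SiftReg] {r : ℕ} (hr : r < ℓ) (q : SiftState)
    (g : SiftReg → Bool) :
    ((upPotential D H r).next SiftState.reg (q.onHeads ℓ) +
        (upPotential D H r).mem (Function.update g q.reg true)) * D (H q.reg.index) ≤
      (upPotential D H r).pending q.reg + (upPotential D H r).mem g * D (H q.reg.index) := by
  by_cases hq : q.reg = .up r
  · obtain rfl : q = .backward r := by
      rcases q with i | i <;> simp_all [SiftState.reg]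
    have hnext : (upPotential D H r).next SiftState.reg ((SiftState.backward r).onHeads ℓ) = 0 := by
      rw [SiftState.onHeads, if_neg hr.ne]
      exact if_neg (by omega)
    rw [hnext, zero_add]
    simp [upPotential, SiftState.reg, SiftReg.index]
  · have hmem : (upPotential D H r).mem (Function.update g q.reg true) =
        (upPotential D H r).mem g := by
      simp only [upPotential, Function.update_of_ne (Ne.symm hq)]
    rw [add_mul, upPotential_next_onHeads D hr hq, hmem]

variable [DiscreteMeasurableSpace Ω]

theorem lintegral_sift_apply [DecidableEq SiftReg]
    (φ : (SiftState ⊕ Outcome) × (SiftReg → Bool) → ℝ≥0∞) (q : SiftState) (g : SiftReg → Bool) :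
    ∫⁻ w, φ (((sift ℓ H).act q w).apply g) ∂D =
      φ (q.onHeads ℓ, Function.update g q.reg true) * D (H q.reg.index) +
        φ (if g q.reg then .inr .lose else siftLoop q.reg.index, g) * D (H q.reg.index)ᶜ := by
  classical
  have hmeas : MeasurableSet (H q.reg.index) := .of_discrete
  rw [← lintegral_add_compl _ hmeas, ← setLIntegral_const, ← setLIntegral_const]
  congr 1
  · exact setLIntegral_congr_fun hmeas fun w hw => by simp only [sift_act_apply, if_pos hw]
  · exact setLIntegral_congr_fun hmeas.compl fun w hw => by
      simp only [sift_act_apply, if_neg (show w ∉ H q.reg.index from hw)]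

variable [IsProbabilityMeasure D]

/-- In a round with probability `D s` of heads, the charge `c` of an unwritten register pays for the
gain `b` of passing it on tails. -/
theorem round_charge_le (s : Set Ω) (written : Bool) {a b c m : ℝ≥0∞} (hc : b ≤ c * D s) :
    (a + m) * D s +
        ((if written then 0 else b) + (m + if written then 0 else c)) * D sᶜ ≤
      a * D s + (m + if written then 0 else c) := by
  have hsum : D s + D sᶜ = 1 := prob_add_prob_compl .of_discrete
  cases written
  · have hb : b * D sᶜ ≤ c * D s := (mul_le_of_le_one_right' prob_le_one).trans hc
    calc _ = a * D s + m * (D s + D sᶜ) + (b * D sᶜ + c * D sᶜ) := by simp; ring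
      _ ≤ a * D s + m * (D s + D sᶜ) + (c * D s + c * D sᶜ) := by gcongr
      _ = a * D s + m * (D s + D sᶜ) + c * (D s + D sᶜ) := by ring
      _ = _ := by rw [hsum]; simp; ring
  · calc _ = a * D s + m * (D s + D sᶜ) := by simp; ring
      _ ≤ _ := by rw [hsum]; simp

theorem winPotential_isSuper (hH : ∀ i ∈ Finset.Icc 1 ℓ, D (H i) ≠ 0) :
    (winPotential D H ℓ).IsSuper D (sift ℓ H) SiftState.reg := by
  classical
  intro q g
  by_cases hq : q.reg.index ∈ Finset.Icc 1 ℓ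
  · have htails : (winPotential D H ℓ).next SiftState.reg
        (if g q.reg then .inr .lose else siftLoop q.reg.index) =
          if g q.reg then 0 else headsProd D H (q.reg.index - 1) := by
      split_ifs
      exacts [rfl, winPotential_next_siftLoop D hq]
    rw [lintegral_sift_apply D fun x =>
      (winPotential D H ℓ).next SiftState.reg x.1 + (winPotential D H ℓ).mem x.2]
    dsimp only
    rw [htails, winPotential_mem_eq_add D g hq, ← winPotential_next_onHeads D hq]
    refine round_charge_le D (H q.reg.index) (g q.reg) ?_
    rw [regValue, ENNReal.div_mul_cancel (hH _ hq) (measure_ne_top _ _)]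
  · have htop : (winPotential D H ℓ).pending q.reg = ⊤ := by
      rcases q with i | i <;> exact if_neg hq
    simp [htop]

theorem upPotential_isSuper {r : ℕ} (hr : r < ℓ) :
    (upPotential D H r).IsSuper D (sift ℓ H) SiftState.reg := by
  classical
  intro q g
  have htails : (upPotential D H r).next SiftState.reg
      (if g q.reg then .inr .lose else siftLoop q.reg.index) = 0 := by
    split_ifs
    exacts [rfl, upPotential_next_siftLoop D r _]
  rw [lintegral_sift_apply D fun x =>
    (upPotential D H r).next SiftState.reg x.1 + (upPotential D H r).mem x.2]
  dsimp only
  rw [htails, zero_add]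
  calc _ ≤ (upPotential D H r).pending q.reg + (upPotential D H r).mem g * D (H q.reg.index) +
        (upPotential D H r).mem g * D (H q.reg.index)ᶜ := by
        gcongr
        exact upPotential_onHeads_le D hr q g
    _ = (upPotential D H r).pending q.reg +
        (upPotential D H r).mem g * (D (H q.reg.index) + D (H q.reg.index)ᶜ) := by ring
    _ = _ := by rw [prob_add_prob_compl .of_discrete, mul_one]

variable [Countable Ω] {M : Algo n Ω L V S} {A : Adversary n Ω L V SiftReg Bool}
  {E : List (Record n Ω L V SiftReg Bool)}

theorem lintegral_winners_sift_le (hM : OneTime (sift ℓ H) M) (hA : RWOblivious (sift ℓ H) M A)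
    (hℓ : 1 ≤ ℓ) (hH : ∀ i ∈ Finset.Icc 1 ℓ, D (H i) ≠ 0) (hE : E ∈ Exec (sift ℓ H) M A k) :
    ∫⁻ ω, winners (sift ℓ H) M A ω
        ∂(cond (Measure.infinitePi fun _ : ℕ => D) (extensionEvent (sift ℓ H) M A E)) ≤
      k * upValue D H ℓ 1 + 2 * ∑ i ∈ Finset.Icc 1 ℓ, regValue D H i := by
  have hpending : (winPotential D H ℓ).pending (.up 1) = upValue D H ℓ 1 :=
    if_pos (Finset.mem_Icc.2 ⟨le_rfl, hℓ⟩)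
  have hmem : (winPotential D H ℓ).mem (sift ℓ H).init =
      2 * ∑ i ∈ Finset.Icc 1 ℓ, regValue D H i := by
    simp only [winPotential, siftRegs, Finset.sum_disjUnion, Finset.sum_map, two_mul]
    rfl
  rw [← hpending, ← hmem]
  exact Potential.lintegral_winners_le (winPotential_isSuper D hH) le_rfl hM hA sift_accesses hE

theorem lintegral_upWritten_le (hM : OneTime (sift ℓ H) M) (hA : RWOblivious (sift ℓ H) M A)
    {r : ℕ} (hr : r ∈ Finset.Ico 1 ℓ) (hE : E ∈ Exec (sift ℓ H) M A k) {t : ℕ}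
    (ht : E.length ≤ t) :
    ∫⁻ ω, (if (advRun (sift ℓ H) M A ω t).gmem (.up r) then 1 else 0)
        ∂(cond (Measure.infinitePi fun _ : ℕ => D) (extensionEvent (sift ℓ H) M A E)) ≤
      min 1 (k * headsProd D H r) := by
  obtain ⟨h1, hrℓ⟩ := Finset.mem_Ico.1 hr
  refine le_min ?_ ?_
  · calc _ ≤ ∫⁻ _, 1 ∂(cond (Measure.infinitePi fun _ : ℕ => D)
          (extensionEvent (sift ℓ H) M A E)) :=
          lintegral_mono fun ω => ite_le_one le_rfl zero_le
      _ ≤ 1 := by rw [lintegral_one]; exact prob_le_one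
  · have hpending : (upPotential D H r).pending (.up 1) = headsProd D H r := if_pos h1
    have hmem : (upPotential D H r).mem (sift ℓ H).init = 0 := by simp [upPotential, sift]
    rw [← add_zero (_ * _), ← hpending, ← hmem]
    exact Potential.lintegral_mem_le (upPotential_isSuper D hrℓ) hM hA sift_accesses hE ht

theorem lintegral_maxSteps_sift_le (hM : OneTime (sift ℓ H) M) (hA : RWOblivious (sift ℓ H) M A)
    (hℓ : 1 ≤ ℓ) (hE : E ∈ Exec (sift ℓ H) M A k) :
    ∫⁻ ω, maxSteps (sift ℓ H) M A ω
        ∂(cond (Measure.infinitePi fun _ : ℕ => D) (extensionEvent (sift ℓ H) M A E)) ≤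
      1 + 2 * ∑ r ∈ Finset.Ico 1 ℓ, min 1 (k * headsProd D H r) := by
  let written (t r : ℕ) (ω : ℕ → Ω) : ℝ≥0∞ :=
    if (advRun (sift ℓ H) M A ω t).gmem (.up r) then 1 else 0
  have hmeas (t r : ℕ) : Measurable (written t r) :=
    measurable_comp_advRun t fun c : Config n Ω L V S SiftState SiftReg Bool =>
      if c.gmem (.up r) then (1 : ℝ≥0∞) else 0
  have hmono : Monotone fun t ω => 1 + 2 * ∑ r ∈ Finset.Ico 1 ℓ, written t r ω := by
    intro s t hst ω
    dsimp only
    gcongr with r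
    exact hM.monotone_written_advRun (.up r) ω hst
  have hsteps (ω : ℕ → Ω) : maxSteps (sift ℓ H) M A ω ≤
      ⨆ t, (1 + 2 * ∑ r ∈ Finset.Ico 1 ℓ, written t r ω) :=
    iSup_le fun p => iSup_mono fun t => hM.steps_advRun_le hℓ ω p t
  refine (lintegral_mono hsteps).trans ?_
  rw [lintegral_iSup (fun t => by fun_prop) hmono]
  refine iSup_le fun t => (lintegral_mono (hmono (le_max_left t E.length))).trans ?_
  rw [lintegral_add_left measurable_const, lintegral_const_mul _ (by fun_prop),
    lintegral_finsetSum _ fun r _ => hmeas _ r, lintegral_one]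
  gcongr with r hr
  · exact prob_le_one
  · exact lintegral_upWritten_le D hM hA hr hE (le_max_right _ _)

end SiftPotential

section Numerics

theorem headsProb_eq (i : ℕ) : headsProb i = 2 ^ (-(3 / 2 : ℝ) ^ (i - 1)) := by
  rw [headsProb, Real.rpow_neg zero_le_two, one_div]

theorem headsProb_pos (i : ℕ) : 0 < headsProb i := by
  rw [headsProb_eq]
  positivity

theorem one_add_half_le_pow (j : ℕ) : 1 + (j : ℝ) / 2 ≤ (3 / 2 : ℝ) ^ j := by
  have hbernoulli := one_add_mul_le_pow (a := (1 / 2 : ℝ)) (by norm_num) j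
  norm_num at hbernoulli ⊢
  linarith

theorem headsProb_succ_le (j : ℕ) : headsProb (j + 1) ≤ 1 / 2 * (5 / 7) ^ j := by
  have hsqrt : (2 : ℝ) ^ (-(1 / 2) : ℝ) ≤ 5 / 7 := by
    rw [Real.rpow_neg zero_le_two, ← Real.sqrt_eq_rpow]
    exact inv_le_of_inv_le₀ (by norm_num) (Real.le_sqrt_of_sq_le (by norm_num))
  calc headsProb (j + 1) ≤ 2 ^ (-1 + -(1 / 2) * (j : ℝ)) := by
        rw [headsProb_eq, Nat.add_sub_cancel]
        exact Real.rpow_le_rpow_of_exponent_le one_le_two (by linarith [one_add_half_le_pow j])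
    _ = 1 / 2 * (2 ^ (-(1 / 2) : ℝ)) ^ j := by
        rw [Real.rpow_add two_pos, Real.rpow_mul zero_le_two, Real.rpow_natCast,
          Real.rpow_neg_one, one_div]
    _ ≤ _ := by gcongr

theorem sum_headsProb_le (ℓ : ℕ) : ∑ i ∈ Finset.Icc 1 ℓ, headsProb i ≤ 7 / 4 := by
  have hgeom : ∑ j ∈ Finset.range ℓ, (5 / 7 : ℝ) ^ j ≤ (1 - 5 / 7)⁻¹ :=
    sum_le_hasSum _ (fun _ _ => by positivity)
      (hasSum_geometric_of_lt_one (by norm_num) (by norm_num))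
  calc ∑ i ∈ Finset.Icc 1 ℓ, headsProb i
      = ∑ j ∈ Finset.range ℓ, headsProb (j + 1) := by
        rw [Finset.range_eq_Ico, Finset.sum_Ico_add' headsProb 0 ℓ 1]
        rfl
    _ ≤ ∑ j ∈ Finset.range ℓ, 1 / 2 * (5 / 7 : ℝ) ^ j :=
        Finset.sum_le_sum fun j _ => headsProb_succ_le j
    _ = 1 / 2 * ∑ j ∈ Finset.range ℓ, (5 / 7 : ℝ) ^ j := by rw [Finset.mul_sum]
    _ ≤ 1 / 2 * (1 - 5 / 7)⁻¹ := by gcongr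
    _ = 7 / 4 := by norm_num

theorem one_le_logb_two {K : ℕ} (hK : 2 ≤ K) : 1 ≤ Real.logb 2 K := by
  rw [Real.le_logb_iff_rpow_le one_lt_two (by positivity), Real.rpow_one]
  exact_mod_cast hK

theorem logb_two_le_pow {K m : ℕ} (hK : 2 ≤ K)
    (hm : ⌈Real.logb (3 / 2) (Real.logb 2 K)⌉₊ ≤ m) : Real.logb 2 K ≤ (3 / 2 : ℝ) ^ m := by
  have hpos : 0 < Real.logb 2 K := one_pos.trans_le (one_le_logb_two hK)
  have hle := (Nat.le_ceil _).trans (Nat.cast_le (α := ℝ).2 hm)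
  rwa [Real.logb_le_iff_le_rpow (by norm_num) hpos, Real.rpow_natCast] at hle

theorem logb_two_add_le {K m : ℕ} (hK : 2 ≤ K)
    (hm : ⌈Real.logb (3 / 2) (Real.logb 2 K)⌉₊ ≤ m) (s : ℕ) :
    Real.logb 2 K + (2 - 2 * (3 / 2 : ℝ) ^ (m + s)) ≤ 1 + -s := by
  have hb := one_add_half_le_pow s
  calc Real.logb 2 K + (2 - 2 * (3 / 2 : ℝ) ^ (m + s))
      ≤ Real.logb 2 K + (2 - 2 * (Real.logb 2 K * (3 / 2) ^ s)) := by
        rw [pow_add]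
        gcongr
        exact logb_two_le_pow hK hm
    _ ≤ 1 + -s := by
        nlinarith [mul_nonneg (sub_nonneg.2 (one_le_logb_two hK))
          (show 0 ≤ 2 * (3 / 2 : ℝ) ^ s - 1 by linarith [s.cast_nonneg (α := ℝ)])]

theorem mul_two_rpow_le {k K m : ℕ} (hkK : k ≤ K) (hK : 2 ≤ K)
    (hm : ⌈Real.logb (3 / 2) (Real.logb 2 K)⌉₊ ≤ m) (s : ℕ) :
    (k : ℝ) * 2 ^ (2 - 2 * (3 / 2 : ℝ) ^ (m + s)) ≤ 2 * (1 / 2) ^ s := by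
  calc (k : ℝ) * 2 ^ (2 - 2 * (3 / 2 : ℝ) ^ (m + s))
      ≤ K * 2 ^ (2 - 2 * (3 / 2 : ℝ) ^ (m + s)) := by gcongr
    _ = 2 ^ (Real.logb 2 K + (2 - 2 * (3 / 2 : ℝ) ^ (m + s))) := by
        rw [Real.rpow_add two_pos, Real.rpow_logb two_pos (by norm_num) (by positivity)]
    _ ≤ 2 ^ (1 + -(s : ℝ)) :=
        Real.rpow_le_rpow_of_exponent_le one_le_two (logb_two_add_le hK hm s)
    _ = 2 * (1 / 2) ^ s := by
        rw [Real.rpow_add two_pos, Real.rpow_neg zero_le_two, Real.rpow_natCast, Real.rpow_one,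
          one_div, inv_pow]

theorem sum_Ico_le_add_two {a : ℕ → ℝ} {m : ℕ} (hnonneg : ∀ r, 0 ≤ a r) (hone : ∀ r, a r ≤ 1)
    (hgeom : ∀ s, a (m + 1 + s) ≤ (1 / 2) ^ s) (N : ℕ) : ∑ r ∈ Finset.Ico 1 N, a r ≤ m + 2 := by
  calc ∑ r ∈ Finset.Ico 1 N, a r ≤ ∑ r ∈ Finset.Ico 1 (m + 1 + N), a r :=
        Finset.sum_le_sum_of_subset_of_nonneg (Finset.Ico_subset_Ico_right (by omega))
          fun r _ _ => hnonneg r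
    _ = ∑ r ∈ Finset.Ico 1 (m + 1), a r + ∑ s ∈ Finset.range N, a (m + 1 + s) := by
        rw [← Finset.sum_Ico_consecutive a (Nat.le_add_left 1 m) (Nat.le_add_right _ N),
          Finset.sum_Ico_eq_sum_range a (m + 1), Nat.add_sub_cancel_left]
    _ ≤ ∑ r ∈ Finset.Ico 1 (m + 1), 1 + ∑ s ∈ Finset.range N, (1 / 2 : ℝ) ^ s :=
        add_le_add (Finset.sum_le_sum fun r _ => hone r) (Finset.sum_le_sum fun s _ => hgeom s)
    _ ≤ m + 2 := by
        simpa using sum_geometric_two_le N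

theorem three_halves_le_logb_two {k : ℕ} (hk : 3 ≤ k) : 3 / 2 ≤ Real.logb 2 k := by
  rw [Real.le_logb_iff_rpow_le one_lt_two (by positivity)]
  calc (2 : ℝ) ^ (3 / 2 : ℝ) = 2 * √2 := by
        rw [show (3 / 2 : ℝ) = 1 + 1 / 2 by norm_num, Real.rpow_add two_pos, Real.rpow_one,
          ← Real.sqrt_eq_rpow]
    _ ≤ 2 * (3 / 2) := by
        gcongr
        exact Real.sqrt_le_iff.2 ⟨by norm_num, by norm_num⟩
    _ ≤ k := by
        norm_num
        exact_mod_cast hk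

theorem ceil_logb_bound {k : ℕ} (hk : 3 ≤ k) :
    ((2 * ⌈Real.logb (3 / 2) (Real.logb 2 (max k 2 : ℕ))⌉₊ + 7 : ℕ) : ℝ) ≤
      11 * (Real.log 2 / Real.log (3 / 2)) * Real.logb 2 (Real.logb 2 k) := by
  rw [max_eq_left (by omega : 2 ≤ k)]
  have hlog := three_halves_le_logb_two hk
  have hone : 1 ≤ Real.logb (3 / 2) (Real.logb 2 k) := by
    rwa [Real.le_logb_iff_rpow_le (by norm_num) (by linarith), Real.rpow_one]
  have hbase : Real.log 2 / Real.log (3 / 2) * Real.logb 2 (Real.logb 2 k) =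
      Real.logb (3 / 2) (Real.logb 2 k) := by
    rw [← Real.log_div_log (b := 2) (x := Real.logb 2 k), ← Real.log_div_log (b := 3 / 2)]
    have hne : Real.log 2 ≠ 0 := (Real.log_pos one_lt_two).ne'
    field_simp
  rw [mul_assoc, hbase]
  have hceil := Nat.ceil_lt_add_one (zero_le_one.trans hone)
  push_cast
  linarith

theorem one_le_arrayLen (n : ℕ) : 1 ≤ arrayLen n := le_max_left _ _

theorem ceil_logb_le_arrayLen (n : ℕ) :
    ⌈Real.logb (3 / 2) (Real.logb 2 (max n 2 : ℕ))⌉₊ ≤ arrayLen n := by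
  rcases le_total n 2 with hn | hn
  · simp [max_eq_right hn]
  · rw [max_eq_left hn]
    exact le_max_right _ _

end Numerics

section Bounds

variable {Ω : Type*} [MeasurableSpace Ω] {D : Measure Ω} {H : ℕ → Set Ω} {ℓ : ℕ}

theorem headsProd_eq (hH : ∀ i, 1 ≤ i → i ≤ ℓ → D (H i) = ENNReal.ofReal (headsProb i)) {i : ℕ}
    (hi : i ≤ ℓ) : headsProd D H i = ENNReal.ofReal (2 ^ (2 - 2 * (3 / 2 : ℝ) ^ i)) := by
  induction i with
  | zero => simp [headsProd_zero]
  | succ i ih =>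
    rw [← headsProd_pred_mul D i.succ_pos, Nat.succ_sub_one, ih (by omega), hH _ (by omega) hi,
      ← ENNReal.ofReal_mul (by positivity), headsProb_eq, Nat.add_sub_cancel,
      ← Real.rpow_add two_pos]
    congr 2
    ring

theorem regValue_eq (hH : ∀ i, 1 ≤ i → i ≤ ℓ → D (H i) = ENNReal.ofReal (headsProb i)) {i : ℕ}
    (h1 : 1 ≤ i) (hi : i ≤ ℓ) : regValue D H i = ENNReal.ofReal (4 * headsProb i) := by
  rw [regValue, headsProd_eq hH (show i - 1 ≤ ℓ by omega), hH i h1 hi,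
    ← ENNReal.ofReal_div_of_pos (headsProb_pos i)]
  congr 1
  rw [headsProb_eq, div_eq_iff (by positivity), mul_assoc, ← Real.rpow_add two_pos,
    show (4 : ℝ) = 2 ^ (2 : ℝ) by norm_num, ← Real.rpow_add two_pos]
  congr 1
  ring

theorem mul_upValue_le [IsProbabilityMeasure D] {n k : ℕ} (hk : k ≤ n)
    (hH : ∀ i, 1 ≤ i → i ≤ arrayLen n → D (H i) = ENNReal.ofReal (headsProb i)) :
    k * upValue D H (arrayLen n) 1 ≤ 2 := by
  have hle_one : headsProd D H (arrayLen n - 1) ≤ 1 :=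
    Finset.prod_le_one' fun _ _ => prob_le_one
  calc k * upValue D H (arrayLen n) 1
      ≤ k * headsProd D H (arrayLen n) := by
        gcongr
        exact mul_le_of_le_one_right' hle_one
    _ = ENNReal.ofReal (k * 2 ^ (2 - 2 * (3 / 2 : ℝ) ^ (arrayLen n + 0))) := by
        rw [headsProd_eq hH le_rfl, ENNReal.ofReal_mul k.cast_nonneg, ENNReal.ofReal_natCast,
          add_zero]
    _ ≤ ENNReal.ofReal (2 * (1 / 2) ^ 0) :=
        ENNReal.ofReal_le_ofReal <| mul_two_rpow_le (hk.trans (le_max_left n 2))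
          (le_max_right n 2) (ceil_logb_le_arrayLen n) 0
    _ = 2 := by simp

theorem winners_bound [IsProbabilityMeasure D] {n k : ℕ} (hk : k ≤ n)
    (hH : ∀ i, 1 ≤ i → i ≤ arrayLen n → D (H i) = ENNReal.ofReal (headsProb i)) :
    k * upValue D H (arrayLen n) 1 + 2 * ∑ i ∈ Finset.Icc 1 (arrayLen n), regValue D H i ≤ 16 := by
  have hsum : ∑ i ∈ Finset.Icc 1 (arrayLen n), regValue D H i ≤ 7 :=
    calc ∑ i ∈ Finset.Icc 1 (arrayLen n), regValue D H i
        = ENNReal.ofReal (4 * ∑ i ∈ Finset.Icc 1 (arrayLen n), headsProb i) := by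
          rw [Finset.mul_sum, ENNReal.ofReal_sum_of_nonneg fun i _ => by
            linarith [headsProb_pos i]]
          exact Finset.sum_congr rfl fun i hi =>
            regValue_eq hH (Finset.mem_Icc.1 hi).1 (Finset.mem_Icc.1 hi).2
      _ ≤ ENNReal.ofReal (4 * (7 / 4)) := by
          gcongr
          exact sum_headsProb_le _
      _ = 7 := by norm_num
  calc _ ≤ (2 : ℝ≥0∞) + 2 * 7 := add_le_add (mul_upValue_le hk hH) (by gcongr)
    _ = 16 := by norm_num

theorem steps_bound {k : ℕ}
    (hH : ∀ i, 1 ≤ i → i ≤ ℓ → D (H i) = ENNReal.ofReal (headsProb i)) :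
    1 + 2 * ∑ r ∈ Finset.Ico 1 ℓ, min 1 (k * headsProd D H r) ≤
      ((2 * ⌈Real.logb (3 / 2) (Real.logb 2 (max k 2 : ℕ))⌉₊ + 7 : ℕ) : ℝ≥0∞) := by
  set m := ⌈Real.logb (3 / 2) (Real.logb 2 (max k 2 : ℕ))⌉₊ with hm
  let a (r : ℕ) : ℝ := min 1 (k * 2 ^ (2 - 2 * (3 / 2 : ℝ) ^ r))
  have ha_nonneg (r : ℕ) : 0 ≤ a r := by positivity
  have ha_geom (s : ℕ) : a (m + 1 + s) ≤ (1 / 2) ^ s := by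
    refine (min_le_right _ _).trans ?_
    rw [add_assoc]
    refine (mul_two_rpow_le (le_max_left k 2) (le_max_right k 2) hm.ge (1 + s)).trans_eq ?_
    ring
  have hmin : ∀ r ∈ Finset.Ico 1 ℓ, min 1 (k * headsProd D H r) = ENNReal.ofReal (a r) := by
    intro r hr
    rw [headsProd_eq hH (Finset.mem_Ico.1 hr).2.le, ENNReal.ofReal_min, ENNReal.ofReal_one,
      ENNReal.ofReal_mul k.cast_nonneg, ENNReal.ofReal_natCast]
  calc 1 + 2 * ∑ r ∈ Finset.Ico 1 ℓ, min 1 (k * headsProd D H r)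
      = 1 + 2 * ENNReal.ofReal (∑ r ∈ Finset.Ico 1 ℓ, a r) := by
        rw [Finset.sum_congr rfl hmin, ENNReal.ofReal_sum_of_nonneg fun r _ => ha_nonneg r]
    _ ≤ 1 + 2 * ENNReal.ofReal ((m + 2 : ℕ) : ℝ) := by
        gcongr
        push_cast
        exact sum_Ico_le_add_two ha_nonneg (fun r => min_le_left _ _) ha_geom ℓ
    _ = ((1 + 2 * (m + 2) : ℕ) : ℝ≥0∞) := by
        rw [ENNReal.ofReal_natCast]
        norm_cast
    _ ≤ _ := Nat.cast_le.2 (by omega)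

end Bounds

end GroupElect

theorem lemma3p5 :
    ∃ C : ℝ, ∀ (n : ℕ) (Ω : Type*) [Countable Ω] [MeasurableSpace Ω] [DiscreteMeasurableSpace Ω]
      (D : MeasureTheory.Measure Ω) [MeasureTheory.IsProbabilityMeasure D] (H : ℕ → Set Ω),
      (∀ i, 1 ≤ i → i ≤ GroupElect.arrayLen n →
        D (H i) = ENNReal.ofReal (GroupElect.headsProb i)) →
      ∀ (L V S : Type*) (M : GroupElect.Algo n Ω L V S),
        GroupElect.OneTime (GroupElect.sift (GroupElect.arrayLen n) H) M →
        GroupElect.NotAllLose (GroupElect.sift (GroupElect.arrayLen n) H) M ∧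
        ∀ A : GroupElect.Adversary n Ω L V GroupElect.SiftReg Bool,
          GroupElect.RWOblivious (GroupElect.sift (GroupElect.arrayLen n) H) M A →
          ∀ k : ℕ, 1 ≤ k → k ≤ n →
            GroupElect.effectiveness D (GroupElect.sift (GroupElect.arrayLen n) H) M A k ≤ 16 ∧
            GroupElect.expMaxStep D (GroupElect.sift (GroupElect.arrayLen n) H) M A k ≤
              ((2 * ⌈Real.logb (3 / 2) (Real.logb 2 (max k 2 : ℕ))⌉₊ + 7 : ℕ) : ENNReal) ∧
            (3 ≤ k →
              GroupElect.expMaxStep D (GroupElect.sift (GroupElect.arrayLen n) H) M A k ≤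
                ENNReal.ofReal (C * Real.logb 2 (Real.logb 2 k))) := by
  refine ⟨11 * (Real.log 2 / Real.log (3 / 2)), ?_⟩
  intro n Ω _ _ _ D _ H hH L V S M hM
  have hℓ := GroupElect.one_le_arrayLen n
  refine ⟨hM.notAllLose, fun A hA k _ hk => ?_⟩
  have hne : ∀ i ∈ Finset.Icc 1 (GroupElect.arrayLen n), D (H i) ≠ 0 := fun i hi => by
    rw [hH i (Finset.mem_Icc.1 hi).1 (Finset.mem_Icc.1 hi).2]
    exact (ENNReal.ofReal_pos.2 (GroupElect.headsProb_pos i)).ne'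
  have hsteps : GroupElect.expMaxStep D (GroupElect.sift (GroupElect.arrayLen n) H) M A k ≤
      ((2 * ⌈Real.logb (3 / 2) (Real.logb 2 (max k 2 : ℕ))⌉₊ + 7 : ℕ) : ENNReal) :=
    iSup₂_le fun E hE =>
      (GroupElect.lintegral_maxSteps_sift_le D hM hA hℓ hE).trans (GroupElect.steps_bound hH)
  refine ⟨iSup₂_le fun E hE => (GroupElect.lintegral_winners_sift_le D hM hA hℓ hne hE).trans
    (GroupElect.winners_bound hk hH), hsteps, fun h3 => hsteps.trans ?_⟩
  rw [← ENNReal.ofReal_natCast]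
  exact ENNReal.ofReal_le_ofReal (GroupElect.ceil_logb_bound h3)
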